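/- Let $(M,g)$ be a stationary Lorentzian manifold, that is, a smooth finite-dimensional (Hausdorff, second countable) manifold with a smooth Lorentzian metric $g$ of index one and a smooth timelike Killing vector field $\mathcal Y$. Let $\gamma:[0,1]\to M$ be a closed geodesic (a geodesic with $\gamma(0)=\gamma(1)$ and $\dot\gamma(0)=\dot\gamma(1)$), and for an integer $N\ge 1$ let $\gamma^{(N)}(t)=\widetilde\gamma(Nt)$, $t\in[0,1]$, be its $N$-th iterate, where $\widetilde\gamma:\mathbb R\to M$ is the $1$-periodic extension of $\gamma$. For a closed geodesic $\sigma:[0,1]\to M$, let $T_\sigma\mathcal N$ be the space of periodic vector fields $V$ along $\sigma$ of Sobolev class $H^1$ for which $$g\big(\tfrac{\mathrm D}{\mathrm dt}V,\mathcal Y\big)-g\big(V,\tfrac{\mathrm D}{\mathrm dt}\mathcal Y\big)$$ is almost everywhere equal to a constant on $[0,1]$, and let the Morse index $\mu(\sigma)$ be the index on $T_\sigma\mathcal N$ (the supremum of the dimensions of the linear subspaces on which the form is negative definite) of the index form $$I_\sigma(V,W)=\int_0^1 g\big(\tfrac{\mathrm D}{\mathrm dt}V,\tfrac{\mathrm D}{\mathrm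 dt}W\big)+g\big(R(\dot\sigma,V)\dot\sigma,W\big)\,\mathrm dt,$$ where $R(X,Z)=[\nabla_X,\nabla_Z]-\nabla_{[X,Z]}$ is the curvature tensor of the Levi-Civita connection $\nabla$ of $g$. Then $\mu(\gamma^{(N)})$ is finite for every $N\ge 1$, and there is a bounded sequence of integers $(d_N)_{N\ge1}$ such that the sequence $N\mapsto \mu(\gamma^{(N)})+d_N\in\mathbb Z$ is nondecreasing. -/

import Mathlib

open scoped Manifold ContDiff
open MeasureTheory Set

noncomputable section

/-- The index `n₋(B)` of a form `B` on a space `S` of vectors: the supremum, in `ℕ∞`, of the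
dimensions of the linear subspaces `W ⊆ S` on which `B` is negative definite. -/
def negIndex {X : Type*} [AddCommGroup X] [Module ℝ X] (B : X → X → ℝ) (S : Set X) : ℕ∞ :=
  ⨆ (W : Submodule ℝ X) (_ : (W : Set X) ⊆ S) (_ : ∀ w ∈ W, w ≠ 0 → B w w < 0),
    Cardinal.toENat (Module.rank ℝ W)

section Geometry

variable {n : ℕ} {M : Type*} [TopologicalSpace M] [ChartedSpace (EuclideanSpace ℝ (Fin n)) M]
  [IsManifold (𝓡 n) ∞ M]

/-- The coefficients, in the chart around `x₀` and at the point with coordinates `y`, of a field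
`b` of bilinear forms on the tangent spaces: `(u, v) ↦ b(∑ uⁱ ∂ᵢ, ∑ vʲ ∂ⱼ)`. -/
def chartForm (b : (p : M) → TangentSpace (𝓡 n) p →L[ℝ] TangentSpace (𝓡 n) p →L[ℝ] ℝ)
    (x₀ : M) (y : EuclideanSpace ℝ (Fin n)) :
    EuclideanSpace ℝ (Fin n) →L[ℝ] EuclideanSpace ℝ (Fin n) →L[ℝ] ℝ :=
  let p : M := (extChartAt (𝓡 n) x₀).symm y
  let A : EuclideanSpace ℝ (Fin n) →L[ℝ] EuclideanSpace ℝ (Fin n) :=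
    tangentCoordChange (𝓡 n) x₀ p p
  ContinuousLinearMap.bilinearComp (b p) A A

variable (n M) in
/-- A smooth Lorentzian metric: a field of nondegenerate symmetric bilinear forms of index one
whose coefficients in charts are smooth. -/
structure LorentzMetric where
  /-- The bilinear form on each tangent space. -/
  inner (p : M) : TangentSpace (𝓡 n) p →L[ℝ] TangentSpace (𝓡 n) p →L[ℝ] ℝ
  symm (p : M) (v w : TangentSpace (𝓡 n) p) : inner p v w = inner p w v
  nondegenerate (p : M) (v : TangentSpace (𝓡 n) p) (hv : ∀ w, inner p v w = 0) : v = 0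
  index_eq_one (p : M) : negIndex (fun v w => inner p v w) univ = 1
  smooth (x₀ : M) : ContDiffOn ℝ ∞ (chartForm inner x₀) (extChartAt (𝓡 n) x₀).target

/-- `Y` is a smooth timelike Killing vector field: `g(Y, Y) < 0`, and the Lie derivative of `g`
along `Y` vanishes, that is, `Y (g(V, W)) = g([Y, V], W) + g(V, [Y, W])`. -/
structure IsTimelikeKilling (g : LorentzMetric n M) (Y : (p : M) → TangentSpace (𝓡 n) p) :
    Prop where
  contMDiff : ContMDiff (𝓡 n) (𝓡 n).tangent ∞ (fun p ↦ (⟨p, Y p⟩ : TangentBundle (𝓡 n) M))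
  timelike (p : M) : g.inner p (Y p) (Y p) < 0
  killing (p : M) (V W : (q : M) → TangentSpace (𝓡 n) q)
    (hV : MDifferentiableAt (𝓡 n) (𝓡 n).tangent
      (fun q ↦ (⟨q, V q⟩ : TangentBundle (𝓡 n) M)) p)
    (hW : MDifferentiableAt (𝓡 n) (𝓡 n).tangent
      (fun q ↦ (⟨q, W q⟩ : TangentBundle (𝓡 n) M)) p) :
    mfderiv (𝓡 n) 𝓘(ℝ, ℝ) (fun q ↦ g.inner q (V q) (W q)) p (Y p) =
      g.inner p (VectorField.mlieBracket (𝓡 n) Y V p) (W p) +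
      g.inner p (V p) (VectorField.mlieBracket (𝓡 n) Y W p)

/-! ### The Levi-Civita connection and the curvature in the coordinates of a chart

Below, `x₀` stands for the chart around `x₀`, and `y` for a point of the coordinate space. The
tangent space `TangentSpace (𝓡 n) p` is the coordinate space of the chart around `p`, so the
formulas for `x₀ = p` give tensors at `p`. -/

/-- The metric coefficients in the chart around `x₀`, at the point with coordinates `y`. -/
def chartMetric (g : LorentzMetric n M) (x₀ : M) (y : EuclideanSpace ℝ (Fin n)) :
    EuclideanSpace ℝ (Fin n) →L[ℝ] EuclideanSpace ℝ (Fin n) →L[ℝ] ℝ :=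
  chartForm g.inner x₀ y

/-- The Christoffel symbol of the first kind as a covector:
`w ↦ (∂_u g(v, w) + ∂_v g(u, w) - ∂_w g(u, v)) / 2`. -/
def christoffelLower (g : LorentzMetric n M) (x₀ : M) (y u v : EuclideanSpace ℝ (Fin n)) :
    EuclideanSpace ℝ (Fin n) →L[ℝ] ℝ :=
  (1 / 2 : ℝ) • (fderiv ℝ (chartMetric g x₀) y u v + fderiv ℝ (chartMetric g x₀) y v u -
    ((fderiv ℝ (chartMetric g x₀) y).flip u).flip v)

/-- The Christoffel symbol `Γ(u, v)` of the Levi-Civita connection: the vector with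
`g(Γ(u, v), w) = (∂_u g(v, w) + ∂_v g(u, w) - ∂_w g(u, v)) / 2` for all `w`. -/
def christoffel (g : LorentzMetric n M) (x₀ : M) (y u v : EuclideanSpace ℝ (Fin n)) :
    EuclideanSpace ℝ (Fin n) :=
  (chartMetric g x₀ y).inverse (christoffelLower g x₀ y u v)

/-- The curvature `R(u, v) w = ∇_u ∇_v w - ∇_v ∇_u w` in coordinates (`u`, `v`, `w` constant). -/
def chartCurvature (g : LorentzMetric n M) (x₀ : M) (y u v w : EuclideanSpace ℝ (Fin n)) :
    EuclideanSpace ℝ (Fin n) :=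
  fderiv ℝ (fun z ↦ christoffel g x₀ z v w) y u - fderiv ℝ (fun z ↦ christoffel g x₀ z u w) y v +
    christoffel g x₀ y u (christoffel g x₀ y v w) - christoffel g x₀ y v (christoffel g x₀ y u w)

/-- The Riemann curvature tensor at `p`, with the convention
`R(u, v) = [∇_u, ∇_v] - ∇_[u, v]`. -/
def curvature (g : LorentzMetric n M) (p : M) (u v w : TangentSpace (𝓡 n) p) :
    TangentSpace (𝓡 n) p :=
  chartCurvature g p (extChartAt (𝓡 n) p p) u v w

/-! ### Vector fields along a curve -/

/-- The velocity `γ'(t)`. -/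
def velocity (γ : ℝ → M) (t : ℝ) : TangentSpace (𝓡 n) (γ t) :=
  mfderiv 𝓘(ℝ, ℝ) (𝓡 n) γ t (1 : ℝ)

/-- The components, in the chart around `x₀`, of a vector field along `γ`. -/
def chartField (γ : ℝ → M) (V : (t : ℝ) → TangentSpace (𝓡 n) (γ t)) (x₀ : M) (s : ℝ) :
    EuclideanSpace ℝ (Fin n) :=
  tangentCoordChange (𝓡 n) (γ s) x₀ (γ s) (V s)

/-- The covariant derivative `D V / dt` along `γ`: in the coordinates around `γ t` it is
`V' + Γ(γ', V)`. -/
def covDeriv (g : LorentzMetric n M) (γ : ℝ → M) (V : (t : ℝ) → TangentSpace (𝓡 n) (γ t))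
    (t : ℝ) : TangentSpace (𝓡 n) (γ t) :=
  deriv (chartField γ V (γ t)) t +
    christoffel g (γ t) (extChartAt (𝓡 n) (γ t) (γ t)) (velocity γ t) (V t)

/-- `γ` is (the 1-periodic extension to `ℝ` of) a closed geodesic parametrized by `[0, 1]`.
Constant curves are allowed. -/
structure IsClosedGeodesic (g : LorentzMetric n M) (γ : ℝ → M) : Prop where
  contMDiff : ContMDiff 𝓘(ℝ, ℝ) (𝓡 n) ∞ γ
  periodic : Function.Periodic γ 1
  geodesic (t : ℝ) : covDeriv g γ (velocity γ) t = 0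

/-- The `N`-th iterate `γ^(N)(t) = γ(N t)` of a 1-periodic curve. -/
def iterateCurve (γ : ℝ → M) (N : ℕ) : ℝ → M := fun t ↦ γ (N * t)

/-- `f` is of Sobolev class `H¹` on `[a, b]`: it is the integral of a square integrable
function `u` (its weak derivative). -/
def IsSobolevH1On (f : ℝ → EuclideanSpace ℝ (Fin n)) (a b : ℝ) : Prop :=
  ∃ u : ℝ → EuclideanSpace ℝ (Fin n), MemLp u 2 (volume.restrict (Icc a b)) ∧
    ∀ t ∈ Icc a b, f t = f a + ∫ s in a..t, u s

/-- `V` is of class `H¹` along `γ`: near each `t₀` its components in the chart around `γ t₀`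
are of class `H¹`. -/
def IsSobolevH1Field (γ : ℝ → M) (V : (t : ℝ) → TangentSpace (𝓡 n) (γ t)) : Prop :=
  ∀ t₀ : ℝ, ∃ δ > 0,
    (∀ t ∈ Icc (t₀ - δ) (t₀ + δ), γ t ∈ (chartAt (EuclideanSpace ℝ (Fin n)) (γ t₀)).source) ∧
    IsSobolevH1On (chartField γ V (γ t₀)) (t₀ - δ) (t₀ + δ)

/-- The space `T_γ ΛM` of 1-periodic vector fields of class `H¹` along a 1-periodic curve `γ`. -/
def tangentLoop (γ : ℝ → M) : Set ((t : ℝ) → TangentSpace (𝓡 n) (γ t)) :=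
  {V | IsSobolevH1Field γ V ∧
    ∀ t, (V (t + 1) : EuclideanSpace ℝ (Fin n)) = (V t : EuclideanSpace ℝ (Fin n))}

/-- The space `T_γ 𝒩` of those `V ∈ T_γ ΛM` for which `g(D V / dt, Y) - g(V, D Y / dt)` is
almost everywhere equal to a constant. -/
def tangentConstraint (g : LorentzMetric n M) (Y : (p : M) → TangentSpace (𝓡 n) p)
    (γ : ℝ → M) : Set ((t : ℝ) → TangentSpace (𝓡 n) (γ t)) :=
  {V | V ∈ tangentLoop γ ∧ ∃ C : ℝ, ∀ᵐ t ∂(volume.restrict (Icc (0 : ℝ) 1)),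
    g.inner (γ t) (covDeriv g γ V t) (Y (γ t)) -
      g.inner (γ t) (V t) (covDeriv g γ (fun s ↦ Y (γ s)) t) = C}

/-- The index form `I_γ(V, W) = ∫₀¹ g(D V / dt, D W / dt) + g(R(γ', V) γ', W) dt`. -/
def indexForm (g : LorentzMetric n M) (γ : ℝ → M) (V W : (t : ℝ) → TangentSpace (𝓡 n) (γ t)) :
    ℝ :=
  ∫ t in (0 : ℝ)..1, (g.inner (γ t) (covDeriv g γ V t) (covDeriv g γ W t) +
    g.inner (γ t) (curvature g (γ t) (velocity γ t) (V t) (velocity γ t)) (W t))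

/-- The Morse index `μ(γ)`: the index of the restriction of `I_γ` to `T_γ 𝒩`. -/
def morseIndex (g : LorentzMetric n M) (Y : (p : M) → TangentSpace (𝓡 n) p) (γ : ℝ → M) : ℕ∞ :=
  negIndex (indexForm g γ) (tangentConstraint g Y γ)

end Geometry

end

/-! The index form is indefinite on all periodic fields, but the constraint tames its timelike
direction. Let `C` be the constant value of `g(DV/dt, Y) - g(V, DY/dt)`. If `C = 0`, then `g(DV/dt,
Y) = g(V, DY/dt)` is controlled by `|V|`. Reversing the sign of `g` along `Y` gives the positive
definite form `g(u, u) - 2 g(u, Y)² / g(Y, Y)`, so in a chart the integrand is at least `c |V'|² - K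
|V|²` (`exists_local_lower_bound`).

Finiteness: on a short interval, a field with `C = 0` that vanishes at the left endpoint satisfies a
Poincaré inequality, and the integral of the integrand is nonnegative (`exists_local_nonneg`). Cut
`[0, 1]` into `m` such intervals. The linear map sending `V` to `C` and to its values at the `m`
left endpoints has no negative vector in its kernel, so the index is at most `1 + m n`
(`morseIndex_ne_top`).

Almost monotonicity: let `N < N'` and `c = N' / N`, so that `γ^(N')(t) = γ^(N)(c t)`. Given a field
`V` along `γ^(N)` with `C = 0` and `V(0) = V(1) = 0`, run through it at speed `c` on `[0, 1/c]` and
continue by zero on `[1/c, 1]`. The result is an admissible field along `γ^(N')` with `C = 0`, and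
the index form gets multiplied by `c > 0`. The conditions `C = 0` and `V(0) = 0` cost at most `1 +
n` dimensions, so `μ(γ^(N)) ≤ μ(γ^(N')) + 1 + n` (`morseIndex_le_add_of_reparametrization`).
Replacing `μ(γ^(N))` by the infimum of the tail starting at `N` is then a bounded change and makes
the sequence nondecreasing (`exists_bounded_correction`).

The covariant derivative and the curvature are given in the chart centred at the current point,
which moves along the curve. The transformation laws of the Christoffel symbols and of the curvature
are therefore needed to compute in one fixed chart near each time. -/

noncomputable section

set_option maxSynthPendingDepth 3

/-! ### Transformation laws of Christoffel symbols and curvature under a coordinate change -/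

section FlatGeometry

variable {E : Type*} [NormedAddCommGroup E] [NormedSpace ℝ E]

theorem minSmoothness_two_le_infty : minSmoothness ℝ 2 ≤ (∞ : WithTop ℕ∞) := by
  rw [minSmoothness_of_isRCLikeNormedField]
  exact WithTop.coe_le_coe.2 le_top

/-- The Christoffel symbol of the first kind of the metric coefficients `G`. -/
def flatChristoffelLower (G : E → E →L[ℝ] E →L[ℝ] ℝ) (y u v : E) : E →L[ℝ] ℝ :=
  (1 / 2 : ℝ) • (fderiv ℝ G y u v + fderiv ℝ G y v u - ((fderiv ℝ G y).flip u).flip v)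

/-- The Christoffel symbol of the second kind of the metric coefficients `G`. -/
def flatChristoffel (G : E → E →L[ℝ] E →L[ℝ] ℝ) (y u v : E) : E :=
  (G y).inverse (flatChristoffelLower G y u v)

/-- The curvature of the metric coefficients `G`. -/
def flatCurvature (G : E → E →L[ℝ] E →L[ℝ] ℝ) (y u v w : E) : E :=
  fderiv ℝ (fun z ↦ flatChristoffel G z v w) y u -
    fderiv ℝ (fun z ↦ flatChristoffel G z u w) y v +
    flatChristoffel G y u (flatChristoffel G y v w) -
    flatChristoffel G y v (flatChristoffel G y u w)

/-- The alternating sum of a trilinear form that defines the Christoffel symbols. -/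
def koszulMap : (E →L[ℝ] E →L[ℝ] E →L[ℝ] ℝ) →L[ℝ] (E →L[ℝ] E →L[ℝ] E →L[ℝ] ℝ) :=
  (1 / 2 : ℝ) • (ContinuousLinearMap.id ℝ _ +
    (ContinuousLinearMap.flipₗᵢ ℝ E E (E →L[ℝ] ℝ)).toContinuousLinearEquiv.toContinuousLinearMap -
    (ContinuousLinearMap.compL ℝ E (E →L[ℝ] E →L[ℝ] ℝ) (E →L[ℝ] E →L[ℝ] ℝ)
      (ContinuousLinearMap.flipₗᵢ ℝ E E ℝ).toContinuousLinearEquiv.toContinuousLinearMap) ∘L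
    (ContinuousLinearMap.flipₗᵢ ℝ E E (E →L[ℝ] ℝ)).toContinuousLinearEquiv.toContinuousLinearMap)

/-- The Christoffel symbol as a continuous bilinear map. -/
def christoffelCLM (G : E → E →L[ℝ] E →L[ℝ] ℝ) (y : E) : E →L[ℝ] E →L[ℝ] E :=
  ContinuousLinearMap.compL ℝ E (E →L[ℝ] ℝ) E (G y).inverse ∘L koszulMap (fderiv ℝ G y)

theorem christoffelCLM_apply (G : E → E →L[ℝ] E →L[ℝ] ℝ) (y u v : E) :
    christoffelCLM G y u v = flatChristoffel G y u v := by
  simp only [christoffelCLM, flatChristoffel, ContinuousLinearMap.comp_apply,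
    ContinuousLinearMap.compL_apply]
  congr 1

theorem contDiffAt_christoffelCLM [CompleteSpace E] {G : E → E →L[ℝ] E →L[ℝ] ℝ} {y : E}
    (hG : ContDiffAt ℝ ∞ G y) (hi : (G y).IsInvertible) :
    ContDiffAt ℝ ∞ (christoffelCLM G) y := by
  have h1 : ContDiffAt ℝ ∞ (fun z ↦ (G z).inverse) y := hi.contDiffAt_map_inverse.comp y hG
  have h2 : ContDiffAt ℝ ∞ (fderiv ℝ G) y := hG.fderiv_right (m := ∞) (by simp)
  have h3 : ContDiffAt ℝ ∞ (fun z ↦ koszulMap (fderiv ℝ G z)) y :=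
    koszulMap.contDiff.contDiffAt.comp y h2
  exact ((ContinuousLinearMap.compL ℝ E (E →L[ℝ] ℝ) E).contDiff.contDiffAt.comp y h1).clm_comp h3

theorem flatChristoffel_spec {G : E → E →L[ℝ] E →L[ℝ] ℝ} {y : E} (hi : (G y).IsInvertible)
    (u v w : E) : G y (flatChristoffel G y u v) w =
      (fderiv ℝ G y u v w + fderiv ℝ G y v u w - fderiv ℝ G y w u v) / 2 := by
  obtain ⟨e, he⟩ := hi
  have h1 : G y (flatChristoffel G y u v) = flatChristoffelLower G y u v := by
    simp only [flatChristoffel, ← he, ContinuousLinearMap.inverse_equiv]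
    exact e.apply_symm_apply _
  rw [h1]
  simp only [flatChristoffelLower, smul_apply, add_apply,
    sub_apply, ContinuousLinearMap.flip_apply, smul_eq_mul]
  ring

/-- `G'` is the pullback of the metric coefficients `G` under the local diffeomorphism `φ`. -/
structure IsMetricPullback (G' G : E → E →L[ℝ] E →L[ℝ] ℝ) (φ : E → E) (U U' : Set E) :
    Prop where
  isOpen : IsOpen U
  isOpen' : IsOpen U'
  mapsTo : MapsTo φ U U'
  contDiffOn : ContDiffOn ℝ ∞ φ U
  contDiffOn_metric : ContDiffOn ℝ ∞ G U'
  contDiffOn_metric' : ContDiffOn ℝ ∞ G' U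
  symm : ∀ z ∈ U', ∀ u v, G z u v = G z v u
  isInvertible : ∀ z ∈ U', (G z).IsInvertible
  isInvertible' : ∀ z ∈ U, (G' z).IsInvertible
  surjective : ∀ z ∈ U, Function.Surjective (fderiv ℝ φ z)
  pullback : ∀ z ∈ U, ∀ u v, G' z u v = G (φ z) (fderiv ℝ φ z u) (fderiv ℝ φ z v)

namespace IsMetricPullback

variable {G' G : E → E →L[ℝ] E →L[ℝ] ℝ} {φ : E → E} {U U' : Set E}

/-- Obtained by differentiating the pullback identity with `v` and `w` fixed. The two terms with the
second derivative of `φ` produce the inhomogeneous term in the law for the Christoffel symbols. -/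
theorem fderiv_metric (h : IsMetricPullback G' G φ U U') {y : E} (hy : y ∈ U) (u v w : E) :
    fderiv ℝ G' y u v w =
      fderiv ℝ G (φ y) (fderiv ℝ φ y u) (fderiv ℝ φ y v) (fderiv ℝ φ y w) +
      G (φ y) (fderiv ℝ (fderiv ℝ φ) y u v) (fderiv ℝ φ y w) +
      G (φ y) (fderiv ℝ φ y v) (fderiv ℝ (fderiv ℝ φ) y u w) := by
  have hU := h.isOpen.mem_nhds hy
  have hφ : ContDiffAt ℝ ∞ φ y := h.contDiffOn.contDiffAt hU
  have hφ1 : HasFDerivAt φ (fderiv ℝ φ y) y :=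
    (hφ.differentiableAt (by simp)).hasFDerivAt
  have hφ2 : HasFDerivAt (fderiv ℝ φ) (fderiv ℝ (fderiv ℝ φ) y) y :=
    ((hφ.fderiv_right (m := ∞) (by simp)).differentiableAt (by simp)).hasFDerivAt
  have hG : HasFDerivAt G (fderiv ℝ G (φ y)) (φ y) :=
    ((h.contDiffOn_metric.contDiffAt (h.isOpen'.mem_nhds (h.mapsTo hy))).differentiableAt
      (by simp)).hasFDerivAt
  have hG' : HasFDerivAt G' (fderiv ℝ G' y) y :=
    ((h.contDiffOn_metric'.contDiffAt hU).differentiableAt (by simp)).hasFDerivAt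
  have e1 : HasFDerivAt (fun z ↦ G' z v w) _ y :=
    (hG'.clm_apply (hasFDerivAt_const v y)).clm_apply (hasFDerivAt_const w y)
  have e2 : HasFDerivAt (fun z ↦ G (φ z) (fderiv ℝ φ z v) (fderiv ℝ φ z w)) _ y :=
    ((hG.comp y hφ1).clm_apply (hφ2.clm_apply (hasFDerivAt_const v y))).clm_apply
      (hφ2.clm_apply (hasFDerivAt_const w y))
  have e3 := e1.congr_of_eventuallyEq (f₁ := fun z ↦ G (φ z) (fderiv ℝ φ z v) (fderiv ℝ φ z w))
    (by filter_upwards [hU] with z hz using (h.pullback z hz v w).symm)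
  have e4 := congrArg (fun L : E →L[ℝ] ℝ ↦ L u) (e3.unique e2)
  simp at e4
  linarith

theorem fderiv_fderiv_comm (h : IsMetricPullback G' G φ U U') {y : E} (hy : y ∈ U) (u v : E) :
    fderiv ℝ (fderiv ℝ φ) y u v = fderiv ℝ (fderiv ℝ φ) y v u := by
  have hφ : ContDiffAt ℝ ∞ φ y := h.contDiffOn.contDiffAt (h.isOpen.mem_nhds hy)
  exact (hφ.isSymmSndFDerivAt minSmoothness_two_le_infty).eq u v

/-- The transformation law of the Christoffel symbols. -/
theorem christoffel (h : IsMetricPullback G' G φ U U') {y : E} (hy : y ∈ U) (u v : E) :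
    fderiv ℝ φ y (flatChristoffel G' y u v) =
      flatChristoffel G (φ y) (fderiv ℝ φ y u) (fderiv ℝ φ y v) +
      fderiv ℝ (fderiv ℝ φ) y u v := by
  obtain ⟨e, he⟩ := h.isInvertible _ (h.mapsTo hy)
  apply e.injective
  have he' : ∀ z, e z = G (φ y) z := fun z ↦ by rw [← he]; rfl
  rw [he', he']
  ext w'
  obtain ⟨w, rfl⟩ := h.surjective y hy w'
  -- The Koszul combination contains six terms with the second derivative of `φ`. By the symmetry of
  -- that derivative and of `G`, four cancel and the other two agree, which absorbs the factor `1 /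
  -- 2`.
  rw [← h.pullback y hy, flatChristoffel_spec (h.isInvertible' y hy), map_add,
    add_apply, flatChristoffel_spec (h.isInvertible _ (h.mapsTo hy)),
    h.fderiv_metric hy, h.fderiv_metric hy, h.fderiv_metric hy, h.fderiv_fderiv_comm hy v u,
    h.fderiv_fderiv_comm hy w u, h.fderiv_fderiv_comm hy w v,
    h.symm _ (h.mapsTo hy) (fderiv ℝ (fderiv ℝ φ) y u w),
    h.symm _ (h.mapsTo hy) (fderiv ℝ φ y u) (fderiv ℝ (fderiv ℝ φ) y v w)]
  ring

/-- The derivative of the law `christoffel` in the direction `u`. Its antisymmetrization in `u` and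
`v` yields the tensor law for the curvature. -/
theorem fderiv_christoffel [CompleteSpace E] (h : IsMetricPullback G' G φ U U') {y : E}
    (hy : y ∈ U) (u v w : E) :
    fderiv ℝ (fderiv ℝ φ) y u (flatChristoffel G' y v w) +
      fderiv ℝ φ y (fderiv ℝ (fun z ↦ flatChristoffel G' z v w) y u) =
    fderiv ℝ (christoffelCLM G) (φ y) (fderiv ℝ φ y u) (fderiv ℝ φ y v) (fderiv ℝ φ y w) +
      flatChristoffel G (φ y) (fderiv ℝ (fderiv ℝ φ) y u v) (fderiv ℝ φ y w) +
      flatChristoffel G (φ y) (fderiv ℝ φ y v) (fderiv ℝ (fderiv ℝ φ) y u w) +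
      fderiv ℝ (fderiv ℝ (fderiv ℝ φ)) y u v w := by
  have hU := h.isOpen.mem_nhds hy
  have hφ : ContDiffAt ℝ ∞ φ y := h.contDiffOn.contDiffAt hU
  have hφ1 : HasFDerivAt φ (fderiv ℝ φ y) y :=
    (hφ.differentiableAt (by simp)).hasFDerivAt
  have hφ' : ContDiffAt ℝ ∞ (fderiv ℝ φ) y := hφ.fderiv_right (m := ∞) (by simp)
  have hφ2 : HasFDerivAt (fderiv ℝ φ) (fderiv ℝ (fderiv ℝ φ) y) y :=
    (hφ'.differentiableAt (by simp)).hasFDerivAt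
  have hφ3 : HasFDerivAt (fderiv ℝ (fderiv ℝ φ)) (fderiv ℝ (fderiv ℝ (fderiv ℝ φ)) y) y :=
    ((hφ'.fderiv_right (m := ∞) (by simp)).differentiableAt (by simp)).hasFDerivAt
  have hG : HasFDerivAt (christoffelCLM G) (fderiv ℝ (christoffelCLM G) (φ y)) (φ y) :=
    ((contDiffAt_christoffelCLM (h.contDiffOn_metric.contDiffAt
      (h.isOpen'.mem_nhds (h.mapsTo hy))) (h.isInvertible _ (h.mapsTo hy))).differentiableAt
      (by simp)).hasFDerivAt
  have hG' : HasFDerivAt (christoffelCLM G') (fderiv ℝ (christoffelCLM G') y) y :=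
    ((contDiffAt_christoffelCLM (h.contDiffOn_metric'.contDiffAt hU)
      (h.isInvertible' _ hy)).differentiableAt (by simp)).hasFDerivAt
  have e0 : HasFDerivAt (fun z ↦ christoffelCLM G' z v w) _ y :=
    (hG'.clm_apply (hasFDerivAt_const v y)).clm_apply (hasFDerivAt_const w y)
  simp_rw [christoffelCLM_apply] at e0
  have e1 : HasFDerivAt (fun z ↦ fderiv ℝ φ z (flatChristoffel G' z v w)) _ y :=
    hφ2.clm_apply e0.differentiableAt.hasFDerivAt
  have e2 : HasFDerivAt (fun z ↦ christoffelCLM G (φ z) (fderiv ℝ φ z v) (fderiv ℝ φ z w) +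
      fderiv ℝ (fderiv ℝ φ) z v w) _ y :=
    (((hG.comp y hφ1).clm_apply (hφ2.clm_apply (hasFDerivAt_const v y))).clm_apply
      (hφ2.clm_apply (hasFDerivAt_const w y))).add
      ((hφ3.clm_apply (hasFDerivAt_const v y)).clm_apply (hasFDerivAt_const w y))
  have e3 := e2.congr_of_eventuallyEq (f₁ := fun z ↦ fderiv ℝ φ z (flatChristoffel G' z v w))
    (by filter_upwards [hU] with z hz; rw [christoffelCLM_apply]; exact h.christoffel hz v w)
  have e4 := congrArg (fun L : E →L[ℝ] E ↦ L u) (e1.unique e3)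
  simp [christoffelCLM_apply] at e4
  rw [add_comm] at e4
  rw [e4]
  abel

theorem fderiv_flatChristoffel [CompleteSpace E] {G : E → E →L[ℝ] E →L[ℝ] ℝ} {y : E}
    (hG : ContDiffAt ℝ ∞ G y) (hi : (G y).IsInvertible) (u v w : E) :
    fderiv ℝ (fun z ↦ flatChristoffel G z v w) y u = fderiv ℝ (christoffelCLM G) y u v w := by
  have hG' : HasFDerivAt (christoffelCLM G) (fderiv ℝ (christoffelCLM G) y) y :=
    ((contDiffAt_christoffelCLM hG hi).differentiableAt (by simp)).hasFDerivAt
  have e0 : HasFDerivAt (fun z ↦ christoffelCLM G z v w) _ y :=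
    (hG'.clm_apply (hasFDerivAt_const v y)).clm_apply (hasFDerivAt_const w y)
  simp_rw [christoffelCLM_apply] at e0
  rw [e0.fderiv]
  simp

/-- The curvature is a tensor. -/
theorem curvature [CompleteSpace E] (h : IsMetricPullback G' G φ U U') {y : E}
    (hy : y ∈ U) (u v w : E) :
    fderiv ℝ φ y (flatCurvature G' y u v w) =
      flatCurvature G (φ y) (fderiv ℝ φ y u) (fderiv ℝ φ y v) (fderiv ℝ φ y w) := by
  have hG := h.contDiffOn_metric.contDiffAt (h.isOpen'.mem_nhds (h.mapsTo hy))
  have hi := h.isInvertible _ (h.mapsTo hy)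
  have h1 := h.fderiv_christoffel hy u v w
  have h2 := h.fderiv_christoffel hy v u w
  have hφ : ContDiffAt ℝ ∞ φ y := h.contDiffOn.contDiffAt (h.isOpen.mem_nhds hy)
  have hφ' : ContDiffAt ℝ ∞ (fderiv ℝ φ) y := hφ.fderiv_right (m := ∞) (by simp)
  -- The third derivative of `φ` is symmetric in `u` and `v`, so it drops out of the
  -- antisymmetrization. The terms with second derivatives cancel against those produced by applying
  -- the law `christoffel` to the quadratic terms of the curvature.
  have h3 : fderiv ℝ (fderiv ℝ (fderiv ℝ φ)) y u v = fderiv ℝ (fderiv ℝ (fderiv ℝ φ)) y v u :=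
    (hφ'.isSymmSndFDerivAt minSmoothness_two_le_infty).eq u v
  rw [h3] at h1
  rw [← h.fderiv_fderiv_comm hy u v] at h2
  simp only [flatCurvature, map_sub, map_add, fderiv_flatChristoffel hG hi]
  simp only [h.christoffel hy, map_add, ← christoffelCLM_apply G] at h1 h2 ⊢
  have h1' := eq_sub_of_add_eq' h1
  have h2' := eq_sub_of_add_eq' h2
  rw [h1', h2']
  abel

end IsMetricPullback

end FlatGeometry

/-! ### The metric, its Christoffel symbols and its curvature in different charts of the manifold -/

section ChartGeometry

variable {n : ℕ} {M : Type*} [TopologicalSpace M] [ChartedSpace (EuclideanSpace ℝ (Fin n)) M]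

variable (n) in
/-- The domain of the coordinate change from the chart around `x₀` to the one around `x₁`. -/
def coordChangeDomain (x₀ x₁ : M) : Set (EuclideanSpace ℝ (Fin n)) :=
  ((extChartAt (𝓡 n) x₀).symm.trans (extChartAt (𝓡 n) x₁)).source

theorem extChartAt_mem_coordChangeDomain {x₀ x₁ p : M}
    (h₀ : p ∈ (extChartAt (𝓡 n) x₀).source) (h₁ : p ∈ (extChartAt (𝓡 n) x₁).source) :
    extChartAt (𝓡 n) x₀ p ∈ coordChangeDomain n x₀ x₁ := by
  refine ⟨(extChartAt (𝓡 n) x₀).map_source h₀, ?_⟩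
  have h : (extChartAt (𝓡 n) x₀).symm (extChartAt (𝓡 n) x₀ p) ∈
      (extChartAt (𝓡 n) x₁).source := by
    rwa [(extChartAt (𝓡 n) x₀).left_inv h₀]
  exact h

variable [IsManifold (𝓡 n) ∞ M]

theorem christoffel_eq_flatChristoffel (g : LorentzMetric n M) (x₀ : M) :
    christoffel g x₀ = flatChristoffel (chartMetric g x₀) := rfl

theorem chartCurvature_eq_flatCurvature (g : LorentzMetric n M) (x₀ : M) :
    chartCurvature g x₀ = flatCurvature (chartMetric g x₀) := rfl

/-- The metric at `p` as a bilinear form on the coordinate space. -/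
def metricAt (g : LorentzMetric n M) (p : M) :
    EuclideanSpace ℝ (Fin n) →L[ℝ] EuclideanSpace ℝ (Fin n) →L[ℝ] ℝ := g.inner p

theorem tangentCoordChange_inverse {x₀ x₁ p : M} (h₀ : p ∈ (extChartAt (𝓡 n) x₀).source)
    (h₁ : p ∈ (extChartAt (𝓡 n) x₁).source) (v : EuclideanSpace ℝ (Fin n)) :
    tangentCoordChange (𝓡 n) x₁ x₀ p (tangentCoordChange (𝓡 n) x₀ x₁ p v) = v := by
  rw [tangentCoordChange_comp ⟨⟨h₀, h₁⟩, h₀⟩, tangentCoordChange_self h₀]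

theorem chartMetric_apply (g : LorentzMetric n M) (x₀ : M) (y u v : EuclideanSpace ℝ (Fin n)) :
    chartMetric g x₀ y u v = metricAt g ((extChartAt (𝓡 n) x₀).symm y)
      (tangentCoordChange (𝓡 n) x₀ ((extChartAt (𝓡 n) x₀).symm y)
        ((extChartAt (𝓡 n) x₀).symm y) u)
      (tangentCoordChange (𝓡 n) x₀ ((extChartAt (𝓡 n) x₀).symm y)
        ((extChartAt (𝓡 n) x₀).symm y) v) := rfl

theorem metricAt_eq_chartMetric (g : LorentzMetric n M) {x₀ p : M}
    (hp : p ∈ (extChartAt (𝓡 n) x₀).source) (u v : EuclideanSpace ℝ (Fin n)) :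
    metricAt g p u v = chartMetric g x₀ (extChartAt (𝓡 n) x₀ p)
      (tangentCoordChange (𝓡 n) p x₀ p u) (tangentCoordChange (𝓡 n) p x₀ p v) := by
  rw [chartMetric_apply, (extChartAt (𝓡 n) x₀).left_inv hp,
    tangentCoordChange_inverse (mem_extChartAt_source p) hp,
    tangentCoordChange_inverse (mem_extChartAt_source p) hp]

theorem chartMetric_symm (g : LorentzMetric n M) (x₀ : M) (y u v : EuclideanSpace ℝ (Fin n)) :
    chartMetric g x₀ y u v = chartMetric g x₀ y v u := g.symm _ _ _

/-- Nondegeneracy gives injectivity, and the dimensions agree. The Christoffel symbols are defined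
through `ContinuousLinearMap.inverse`, which takes the default value `0` on maps that are not
invertible, so this is what gives them their meaning. -/
theorem chartMetric_isInvertible (g : LorentzMetric n M) (x₀ : M)
    {y : EuclideanSpace ℝ (Fin n)} (hy : y ∈ (extChartAt (𝓡 n) x₀).target) :
    (chartMetric g x₀ y).IsInvertible := by
  have hp := (extChartAt (𝓡 n) x₀).map_target hy
  set p := (extChartAt (𝓡 n) x₀).symm y with hpdef
  have hinj : Function.Injective (chartMetric g x₀ y) := by
    refine (injective_iff_map_eq_zero _).2 fun u hu ↦ ?_
    have h0 : tangentCoordChange (𝓡 n) x₀ p p u = 0 := by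
      refine g.nondegenerate p _ fun (w : EuclideanSpace ℝ (Fin n)) ↦ ?_
      have h : chartMetric g x₀ y u (tangentCoordChange (𝓡 n) p x₀ p w) = 0 := by rw [hu]; rfl
      rw [chartMetric_apply, ← hpdef,
        tangentCoordChange_inverse (mem_extChartAt_source p) hp] at h
      exact h
    rw [← tangentCoordChange_inverse hp (mem_extChartAt_source p) u, h0, map_zero]
  let D := (LinearMap.toContinuousLinearMap :
    (EuclideanSpace ℝ (Fin n) →ₗ[ℝ] ℝ) ≃ₗ[ℝ] (EuclideanSpace ℝ (Fin n) →L[ℝ] ℝ))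
  have hdim : Module.finrank ℝ (EuclideanSpace ℝ (Fin n)) =
      Module.finrank ℝ (EuclideanSpace ℝ (Fin n) →L[ℝ] ℝ) := by
    rw [← D.finrank_eq]
    exact (Subspace.dual_finrank_eq (K := ℝ) (V := EuclideanSpace ℝ (Fin n))).symm
  have : FiniteDimensional ℝ (EuclideanSpace ℝ (Fin n) →L[ℝ] ℝ) := D.finiteDimensional
  let e := LinearEquiv.ofInjectiveOfFinrankEq
    (chartMetric g x₀ y : EuclideanSpace ℝ (Fin n) →ₗ[ℝ] EuclideanSpace ℝ (Fin n) →L[ℝ] ℝ)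
    hinj hdim
  refine ⟨e.toContinuousLinearEquiv, ?_⟩
  ext u v
  rfl

theorem fderiv_coordChange {x₀ x₁ p : M} (h₀ : p ∈ (extChartAt (𝓡 n) x₀).source)
    (h₁ : p ∈ (extChartAt (𝓡 n) x₁).source) :
    HasFDerivAt (extChartAt (𝓡 n) x₁ ∘ (extChartAt (𝓡 n) x₀).symm)
      (tangentCoordChange (𝓡 n) x₀ x₁ p) (extChartAt (𝓡 n) x₀ p) := by
  have := hasFDerivWithinAt_tangentCoordChange (I := 𝓡 n) (x := x₀) (y := x₁) (z := p) ⟨h₀, h₁⟩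
  simpa [ModelWithCorners.range_eq_univ] using this

theorem contDiffOn_coordChange (x₀ x₁ : M) :
    ContDiffOn ℝ ∞ (extChartAt (𝓡 n) x₁ ∘ (extChartAt (𝓡 n) x₀).symm)
      (coordChangeDomain n x₀ x₁) :=
  contDiffOn_ext_coord_change x₁ x₀

/-- Both families of coefficients describe the same tensor on `M`, so the coordinate change pulls
one back to the other. This makes the laws of the preceding part available on `M`. -/
theorem isMetricPullback_chartMetric (g : LorentzMetric n M) (x₀ x₁ : M) :
    IsMetricPullback (chartMetric g x₀) (chartMetric g x₁)
      (extChartAt (𝓡 n) x₁ ∘ (extChartAt (𝓡 n) x₀).symm) (coordChangeDomain n x₀ x₁)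
      (extChartAt (𝓡 n) x₁).target where
  isOpen := by
    have := (continuousOn_extChartAt_symm (I := 𝓡 n) x₀).isOpen_inter_preimage
      (isOpen_extChartAt_target (I := 𝓡 n) x₀) (isOpen_extChartAt_source (I := 𝓡 n) x₁)
    exact this
  isOpen' := isOpen_extChartAt_target (I := 𝓡 n) x₁
  mapsTo := fun y hy ↦ (extChartAt (𝓡 n) x₁).map_source hy.2
  contDiffOn := contDiffOn_coordChange x₀ x₁
  contDiffOn_metric := g.smooth x₁
  contDiffOn_metric' := (g.smooth x₀).mono fun y hy ↦ hy.1
  symm := fun z _ u v ↦ chartMetric_symm g x₁ z u v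
  isInvertible := fun z hz ↦ chartMetric_isInvertible g x₁ hz
  isInvertible' := fun z hz ↦ chartMetric_isInvertible g x₀ hz.1
  surjective := by
    intro z hz w
    have h₀ := (extChartAt (𝓡 n) x₀).map_target hz.1
    have h₁ : (extChartAt (𝓡 n) x₀).symm z ∈ (extChartAt (𝓡 n) x₁).source := hz.2
    have h := fderiv_coordChange h₀ h₁
    rw [(extChartAt (𝓡 n) x₀).right_inv hz.1] at h
    rw [h.fderiv]
    exact ⟨_, tangentCoordChange_inverse h₁ h₀ w⟩
  pullback := by
    intro z hz u v
    have h₀ := (extChartAt (𝓡 n) x₀).map_target hz.1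
    have h₁ : (extChartAt (𝓡 n) x₀).symm z ∈ (extChartAt (𝓡 n) x₁).source := hz.2
    have h := fderiv_coordChange h₀ h₁
    rw [(extChartAt (𝓡 n) x₀).right_inv hz.1] at h
    rw [h.fderiv, chartMetric_apply]
    set p := (extChartAt (𝓡 n) x₀).symm z
    have hφ : (extChartAt (𝓡 n) x₁ ∘ (extChartAt (𝓡 n) x₀).symm) z =
      extChartAt (𝓡 n) x₁ p := rfl
    rw [hφ, metricAt_eq_chartMetric g h₁,
      tangentCoordChange_comp ⟨⟨h₀, mem_extChartAt_source p⟩, h₁⟩,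
      tangentCoordChange_comp ⟨⟨h₀, mem_extChartAt_source p⟩, h₁⟩]

/-- The curvature tensor computed in the chart around `x₀`. -/
theorem tangentCoordChange_curvature (g : LorentzMetric n M) {x₀ p : M}
    (hp : p ∈ (extChartAt (𝓡 n) x₀).source) (u v w : EuclideanSpace ℝ (Fin n)) :
    tangentCoordChange (𝓡 n) p x₀ p (curvature g p u v w) =
      chartCurvature g x₀ (extChartAt (𝓡 n) x₀ p) (tangentCoordChange (𝓡 n) p x₀ p u)
        (tangentCoordChange (𝓡 n) p x₀ p v) (tangentCoordChange (𝓡 n) p x₀ p w) := by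
  have hpp := mem_extChartAt_source (I := 𝓡 n) p
  have h := (isMetricPullback_chartMetric g p x₀).curvature
    (extChartAt_mem_coordChangeDomain hpp hp) u v w
  rw [(fderiv_coordChange hpp hp).fderiv, Function.comp_apply,
    (extChartAt (𝓡 n) p).left_inv hpp] at h
  exact h

/-- The Christoffel symbols at the center of a chart computed in the chart around `x₀`. -/
theorem tangentCoordChange_christoffel (g : LorentzMetric n M) {x₀ p : M}
    (hp : p ∈ (extChartAt (𝓡 n) x₀).source) (u v : EuclideanSpace ℝ (Fin n)) :
    tangentCoordChange (𝓡 n) p x₀ p (christoffel g p (extChartAt (𝓡 n) p p) u v) =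
      christoffel g x₀ (extChartAt (𝓡 n) x₀ p) (tangentCoordChange (𝓡 n) p x₀ p u)
        (tangentCoordChange (𝓡 n) p x₀ p v) +
      fderiv ℝ (fderiv ℝ (extChartAt (𝓡 n) x₀ ∘ (extChartAt (𝓡 n) p).symm))
        (extChartAt (𝓡 n) p p) u v := by
  have hpp := mem_extChartAt_source (I := 𝓡 n) p
  have h := (isMetricPullback_chartMetric g p x₀).christoffel
    (extChartAt_mem_coordChangeDomain hpp hp) u v
  rw [(fderiv_coordChange hpp hp).fderiv, Function.comp_apply,
    (extChartAt (𝓡 n) p).left_inv hpp] at h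
  exact h

end ChartGeometry

/-! ### Velocity, fields and covariant derivative along a curve in a fixed chart -/

section CurveFields

open scoped Topology

variable {n : ℕ} {M : Type*} [TopologicalSpace M] [ChartedSpace (EuclideanSpace ℝ (Fin n)) M]

variable (n) in
/-- The coordinates of the curve `γ` in the chart around `x₀`. -/
def chartCurve (γ : ℝ → M) (x₀ : M) (t : ℝ) : EuclideanSpace ℝ (Fin n) :=
  extChartAt (𝓡 n) x₀ (γ t)

theorem eventually_mem_source {γ : ℝ → M} {t : ℝ} {x₀ : M} (hγ : ContinuousAt γ t)
    (h : γ t ∈ (extChartAt (𝓡 n) x₀).source) :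
    ∀ᶠ s in 𝓝 t, γ s ∈ (extChartAt (𝓡 n) x₀).source :=
  hγ.eventually_mem ((isOpen_extChartAt_source (I := 𝓡 n) x₀).mem_nhds h)

theorem velocity_eq_deriv {γ : ℝ → M} (hγ : ContMDiff 𝓘(ℝ, ℝ) (𝓡 n) ∞ γ) (t : ℝ) :
    velocity γ t = deriv (chartCurve n γ (γ t)) t := by
  have h : MDifferentiableAt 𝓘(ℝ, ℝ) (𝓡 n) γ t := (hγ t).mdifferentiableAt (by simp)
  simp only [velocity, mfderiv, h, reduceIte, writtenInExtChartAt, extChartAt_model_space_eq_id,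
    PartialEquiv.refl_coe, PartialEquiv.refl_symm, modelWithCornersSelf_coe, range_id,
    fderivWithin_univ, Function.comp_id, id]
  rfl

variable [IsManifold (𝓡 n) ∞ M]

theorem contDiffAt_chartCurve {γ : ℝ → M} (hγ : ContMDiff 𝓘(ℝ, ℝ) (𝓡 n) ∞ γ) {x₀ : M} {t : ℝ}
    (h : γ t ∈ (extChartAt (𝓡 n) x₀).source) : ContDiffAt ℝ ∞ (chartCurve n γ x₀) t := by
  rw [extChartAt_source] at h
  exact contMDiffAt_iff_contDiffAt.1 ((contMDiffAt_extChartAt' (I := 𝓡 n) h).comp t (hγ t))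

theorem hasDerivAt_coordChange {γ : ℝ → M} (hγ : ContMDiff 𝓘(ℝ, ℝ) (𝓡 n) ∞ γ) {x₀ x₁ : M} {t : ℝ}
    (h₀ : γ t ∈ (extChartAt (𝓡 n) x₀).source) (h₁ : γ t ∈ (extChartAt (𝓡 n) x₁).source) :
    HasDerivAt (chartCurve n γ x₁)
      (tangentCoordChange (𝓡 n) x₀ x₁ (γ t) (deriv (chartCurve n γ x₀) t)) t := by
  have h := (fderiv_coordChange h₀ h₁).comp_hasDerivAt t
    ((contDiffAt_chartCurve hγ h₀).differentiableAt (by simp)).hasDerivAt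
  refine h.congr_of_eventuallyEq ?_
  filter_upwards [eventually_mem_source hγ.continuous.continuousAt h₀] with s hs
  simp only [chartCurve, Function.comp_apply, (extChartAt (𝓡 n) x₀).left_inv hs]

theorem tangentCoordChange_velocity {γ : ℝ → M} (hγ : ContMDiff 𝓘(ℝ, ℝ) (𝓡 n) ∞ γ) {x₀ : M}
    {t : ℝ} (h₀ : γ t ∈ (extChartAt (𝓡 n) x₀).source) :
    tangentCoordChange (𝓡 n) (γ t) x₀ (γ t) (velocity γ t) = deriv (chartCurve n γ x₀) t := by
  rw [velocity_eq_deriv hγ]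
  exact (hasDerivAt_coordChange hγ (mem_extChartAt_source (γ t)) h₀).deriv.symm

theorem chartField_self (γ : ℝ → M) (V : ℝ → EuclideanSpace ℝ (Fin n)) (t : ℝ) :
    chartField γ V (γ t) t = V t :=
  tangentCoordChange_self (mem_extChartAt_source (γ t))

theorem chartField_coordChange {γ : ℝ → M} (V : ℝ → EuclideanSpace ℝ (Fin n)) {x₀ x₁ : M} {t : ℝ}
    (h₀ : γ t ∈ (extChartAt (𝓡 n) x₀).source) (h₁ : γ t ∈ (extChartAt (𝓡 n) x₁).source) :
    chartField γ V x₁ t = tangentCoordChange (𝓡 n) x₀ x₁ (γ t) (chartField γ V x₀ t) :=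
  (tangentCoordChange_comp ⟨⟨mem_extChartAt_source (γ t), h₀⟩, h₁⟩).symm

theorem tangentCoordChange_eventuallyEq {γ : ℝ → M} (hγ : Continuous γ)
    {x₀ x₁ : M} {t : ℝ} (h₀ : γ t ∈ (extChartAt (𝓡 n) x₀).source)
    (h₁ : γ t ∈ (extChartAt (𝓡 n) x₁).source) :
    (fun s ↦ tangentCoordChange (𝓡 n) x₀ x₁ (γ s)) =ᶠ[𝓝 t] fun s ↦
      fderiv ℝ (extChartAt (𝓡 n) x₁ ∘ (extChartAt (𝓡 n) x₀).symm) (chartCurve n γ x₀ s) := by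
  filter_upwards [eventually_mem_source hγ.continuousAt h₀,
    eventually_mem_source hγ.continuousAt h₁] with s hs₀ hs₁
  exact (fderiv_coordChange hs₀ hs₁).fderiv.symm

theorem contDiffAt_coordChange {x₀ x₁ p : M} (h₀ : p ∈ (extChartAt (𝓡 n) x₀).source)
    (h₁ : p ∈ (extChartAt (𝓡 n) x₁).source) :
    ContDiffAt ℝ ∞ (extChartAt (𝓡 n) x₁ ∘ (extChartAt (𝓡 n) x₀).symm)
      (extChartAt (𝓡 n) x₀ p) := by
  refine (contDiffOn_coordChange x₀ x₁).contDiffAt (IsOpen.mem_nhds ?_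
    (extChartAt_mem_coordChangeDomain h₀ h₁))
  exact (continuousOn_extChartAt_symm (I := 𝓡 n) x₀).isOpen_inter_preimage
    (isOpen_extChartAt_target (I := 𝓡 n) x₀) (isOpen_extChartAt_source (I := 𝓡 n) x₁)

theorem contDiffAt_tangentCoordChange {γ : ℝ → M} (hγ : ContMDiff 𝓘(ℝ, ℝ) (𝓡 n) ∞ γ)
    {x₀ x₁ : M} {t : ℝ} (h₀ : γ t ∈ (extChartAt (𝓡 n) x₀).source)
    (h₁ : γ t ∈ (extChartAt (𝓡 n) x₁).source) :
    ContDiffAt ℝ ∞ (fun s ↦ tangentCoordChange (𝓡 n) x₀ x₁ (γ s)) t := by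
  refine ContDiffAt.congr_of_eventuallyEq ?_
    (tangentCoordChange_eventuallyEq hγ.continuous h₀ h₁)
  exact ContDiffAt.comp t (f := chartCurve n γ x₀)
    ((contDiffAt_coordChange h₀ h₁).fderiv_right (m := ∞) (by simp))
    (contDiffAt_chartCurve hγ h₀)

/-- The product rule for a field multiplied by the Jacobian of the coordinate change along the
curve. The term with the second derivative is the one compensated by the Christoffel symbols. -/
theorem hasDerivAt_chartField {γ : ℝ → M} (hγ : ContMDiff 𝓘(ℝ, ℝ) (𝓡 n) ∞ γ)
    {V : ℝ → EuclideanSpace ℝ (Fin n)} {x₀ x₁ : M} {t : ℝ}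
    (h₀ : γ t ∈ (extChartAt (𝓡 n) x₀).source) (h₁ : γ t ∈ (extChartAt (𝓡 n) x₁).source)
    (hV : DifferentiableAt ℝ (chartField γ V x₀) t) :
    HasDerivAt (chartField γ V x₁)
      (fderiv ℝ (fderiv ℝ (extChartAt (𝓡 n) x₁ ∘ (extChartAt (𝓡 n) x₀).symm))
        (chartCurve n γ x₀ t) (deriv (chartCurve n γ x₀) t) (chartField γ V x₀ t) +
        tangentCoordChange (𝓡 n) x₀ x₁ (γ t) (deriv (chartField γ V x₀) t)) t := by
  have h1 : HasDerivAt (fun s ↦ fderiv ℝ (extChartAt (𝓡 n) x₁ ∘ (extChartAt (𝓡 n) x₀).symm)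
      (chartCurve n γ x₀ s)) _ t :=
    HasFDerivAt.comp_hasDerivAt (f := chartCurve n γ x₀) t
      (((contDiffAt_coordChange h₀ h₁).fderiv_right (m := ∞) (by simp)).differentiableAt
        (by simp)).hasFDerivAt
      ((contDiffAt_chartCurve hγ h₀).differentiableAt (by simp)).hasDerivAt
  have h2 := h1.congr_of_eventuallyEq (tangentCoordChange_eventuallyEq hγ.continuous h₀ h₁)
  refine (h2.clm_apply hV.hasDerivAt).congr_of_eventuallyEq ?_
  filter_upwards [eventually_mem_source hγ.continuous.continuousAt h₀,
    eventually_mem_source hγ.continuous.continuousAt h₁] with s hs₀ hs₁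
  exact chartField_coordChange V hs₀ hs₁

/-- The covariant derivative along `γ` computed in the chart around `x₀`. -/
def chartCovDeriv (g : LorentzMetric n M) (γ : ℝ → M) (x₀ : M)
    (f : ℝ → EuclideanSpace ℝ (Fin n)) (t : ℝ) : EuclideanSpace ℝ (Fin n) :=
  deriv f t + christoffel g x₀ (chartCurve n γ x₀ t) (deriv (chartCurve n γ x₀) t) (f t)

/-- The inhomogeneous terms from the derivative of the components and from the Christoffel symbols
cancel. Thus `covDeriv`, defined with a chart that changes with `t`, can be computed in one chart
near a given time. -/
theorem tangentCoordChange_covDeriv (g : LorentzMetric n M) {γ : ℝ → M}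
    (hγ : ContMDiff 𝓘(ℝ, ℝ) (𝓡 n) ∞ γ) {V : ℝ → EuclideanSpace ℝ (Fin n)} {x₀ : M} {t : ℝ}
    (h₀ : γ t ∈ (extChartAt (𝓡 n) x₀).source)
    (hV : DifferentiableAt ℝ (chartField γ V x₀) t) :
    tangentCoordChange (𝓡 n) (γ t) x₀ (γ t) (covDeriv g γ V t) =
      chartCovDeriv g γ x₀ (chartField γ V x₀) t := by
  have hs := mem_extChartAt_source (I := 𝓡 n) (γ t)
  have hV' := (hasDerivAt_chartField hγ h₀ hs hV).differentiableAt
  have h1 := (hasDerivAt_chartField hγ hs h₀ hV').deriv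
  have h2 := tangentCoordChange_christoffel g h₀ (velocity γ t) (V t)
  have h3 : chartField γ V x₀ t = tangentCoordChange (𝓡 n) (γ t) x₀ (γ t) (V t) := rfl
  rw [chartField_self, ← velocity_eq_deriv hγ] at h1
  rw [tangentCoordChange_velocity hγ h₀] at h2
  rw [chartCovDeriv, h1, h3]
  have h4 : covDeriv g γ V t = deriv (chartField γ V (γ t)) t +
    christoffel g (γ t) (extChartAt (𝓡 n) (γ t) (γ t)) (velocity γ t) (V t) := rfl
  have h5 : tangentCoordChange (𝓡 n) (γ t) x₀ (γ t) (covDeriv g γ V t) =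
    tangentCoordChange (𝓡 n) (γ t) x₀ (γ t) (deriv (chartField γ V (γ t)) t) +
    tangentCoordChange (𝓡 n) (γ t) x₀ (γ t) (christoffel g (γ t)
      (extChartAt (𝓡 n) (γ t) (γ t)) (velocity γ t) (V t)) := by
    rw [h4]; exact map_add _ _ _
  rw [h5, h2]
  simp only [chartCurve]
  abel

/-- The integrand of the index form. -/
def indexDensity (g : LorentzMetric n M) (γ : ℝ → M) (V : ℝ → EuclideanSpace ℝ (Fin n)) (t : ℝ) :
    ℝ :=
  metricAt g (γ t) (covDeriv g γ V t) (covDeriv g γ V t) +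
    metricAt g (γ t) (curvature g (γ t) (velocity γ t) (V t) (velocity γ t)) (V t)

/-- The quantity that is constant for the fields tangent to the constraint. -/
def constraintDensity (g : LorentzMetric n M) (Y : (p : M) → TangentSpace (𝓡 n) p) (γ : ℝ → M)
    (V : ℝ → EuclideanSpace ℝ (Fin n)) (t : ℝ) : ℝ :=
  metricAt g (γ t) (covDeriv g γ V t) (Y (γ t)) -
    metricAt g (γ t) (V t) (covDeriv g γ (fun s ↦ Y (γ s)) t)

theorem indexDensity_eq (g : LorentzMetric n M) {γ : ℝ → M}
    (hγ : ContMDiff 𝓘(ℝ, ℝ) (𝓡 n) ∞ γ) {V : ℝ → EuclideanSpace ℝ (Fin n)} {x₀ : M} {t : ℝ}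
    (h₀ : γ t ∈ (extChartAt (𝓡 n) x₀).source)
    (hV : DifferentiableAt ℝ (chartField γ V x₀) t) :
    indexDensity g γ V t =
      chartMetric g x₀ (chartCurve n γ x₀ t) (chartCovDeriv g γ x₀ (chartField γ V x₀) t)
        (chartCovDeriv g γ x₀ (chartField γ V x₀) t) +
      chartMetric g x₀ (chartCurve n γ x₀ t)
        (chartCurvature g x₀ (chartCurve n γ x₀ t) (deriv (chartCurve n γ x₀) t)
          (chartField γ V x₀ t) (deriv (chartCurve n γ x₀) t)) (chartField γ V x₀ t) := by
  have h1 := tangentCoordChange_covDeriv g hγ h₀ hV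
  have h2 := tangentCoordChange_curvature g h₀ (velocity γ t) (V t) (velocity γ t)
  rw [tangentCoordChange_velocity hγ h₀] at h2
  refine congrArg₂ (· + ·) ((metricAt_eq_chartMetric g h₀ _ _).trans ?_)
    ((metricAt_eq_chartMetric g h₀ _ _).trans ?_)
  · exact congrArg₂ (fun a b ↦ chartMetric g x₀ (chartCurve n γ x₀ t) a b) h1 h1
  · exact congrArg₂ (fun a b ↦ chartMetric g x₀ (chartCurve n γ x₀ t) a b) h2 rfl

theorem constraintDensity_eq (g : LorentzMetric n M) {Y : (p : M) → TangentSpace (𝓡 n) p}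
    {γ : ℝ → M} (hγ : ContMDiff 𝓘(ℝ, ℝ) (𝓡 n) ∞ γ) {V : ℝ → EuclideanSpace ℝ (Fin n)} {x₀ : M}
    {t : ℝ} (h₀ : γ t ∈ (extChartAt (𝓡 n) x₀).source)
    (hV : DifferentiableAt ℝ (chartField γ V x₀) t)
    (hY : DifferentiableAt ℝ (chartField γ (fun s ↦ Y (γ s)) x₀) t) :
    constraintDensity g Y γ V t =
      chartMetric g x₀ (chartCurve n γ x₀ t) (chartCovDeriv g γ x₀ (chartField γ V x₀) t)
        (chartField γ (fun s ↦ Y (γ s)) x₀ t) -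
      chartMetric g x₀ (chartCurve n γ x₀ t) (chartField γ V x₀ t)
        (chartCovDeriv g γ x₀ (chartField γ (fun s ↦ Y (γ s)) x₀) t) := by
  have h1 := tangentCoordChange_covDeriv g hγ h₀ hV
  have h2 := tangentCoordChange_covDeriv g hγ h₀ hY
  refine congrArg₂ (· - ·) ((metricAt_eq_chartMetric g h₀ _ _).trans ?_)
    ((metricAt_eq_chartMetric g h₀ _ _).trans ?_)
  · exact congrArg₂ (fun a b ↦ chartMetric g x₀ (chartCurve n γ x₀ t) a b) h1 rfl
  · exact congrArg₂ (fun a b ↦ chartMetric g x₀ (chartCurve n γ x₀ t) a b) rfl h2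

theorem contDiffAt_chartField_vectorField {Y : (p : M) → TangentSpace (𝓡 n) p}
    (hY : ContMDiff (𝓡 n) (𝓡 n).tangent ∞ (fun p ↦ (⟨p, Y p⟩ : TangentBundle (𝓡 n) M)))
    {γ : ℝ → M} (hγ : ContMDiff 𝓘(ℝ, ℝ) (𝓡 n) ∞ γ) (t : ℝ) :
    ContDiffAt ℝ ∞ (chartField γ (fun s ↦ Y (γ s)) (γ t)) t := by
  have h := (hY.comp hγ) t
  rw [Bundle.contMDiffAt_totalSpace] at h
  exact contMDiffAt_iff_contDiffAt.1 h.2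

end CurveFields

/-! ### Linear algebra of the index and of Lorentzian forms -/

section NegIndex

variable {X : Type*} [AddCommGroup X] [Module ℝ X]

theorem le_negIndex {B : X → X → ℝ} {S : Set X} {W : Submodule ℝ X} (hS : (W : Set X) ⊆ S)
    (hW : ∀ w ∈ W, w ≠ 0 → B w w < 0) :
    Cardinal.toENat (Module.rank ℝ W) ≤ negIndex B S :=
  le_iSup_of_le W (le_iSup_of_le hS (le_iSup_of_le hW le_rfl))

theorem negIndex_le {B : X → X → ℝ} {S : Set X} {k : ℕ∞}
    (h : ∀ W : Submodule ℝ X, (W : Set X) ⊆ S → (∀ w ∈ W, w ≠ 0 → B w w < 0) →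
      Cardinal.toENat (Module.rank ℝ W) ≤ k) : negIndex B S ≤ k :=
  iSup_le fun W ↦ iSup_le fun hS ↦ iSup_le fun hW ↦ h W hS hW

/-- If a linear map `L` is defined on every negative definite subspace of `S` and its kernel
contains no negative vector, the index on `S` is at most the dimension of the target of `L`. -/
theorem negIndex_le_finrank {F : Type*} [AddCommGroup F] [Module ℝ F] [FiniteDimensional ℝ F]
    {B : X → X → ℝ} {S : Set X}
    (h : ∀ W : Submodule ℝ X, (W : Set X) ⊆ S → ∃ L : W →ₗ[ℝ] F, ∀ w : W, L w = 0 → 0 ≤ B w w) :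
    negIndex B S ≤ Module.finrank ℝ F := by
  refine negIndex_le fun W hS hW ↦ ?_
  obtain ⟨L, hL⟩ := h W hS
  have hinj : Function.Injective L := by
    refine (injective_iff_map_eq_zero L).2 fun w hw ↦ ?_
    by_contra hne
    exact absurd (hW w w.2 fun h0 ↦ hne (Subtype.ext h0)) (not_lt.2 (hL w hw))
  have : FiniteDimensional ℝ W := FiniteDimensional.of_injective L hinj
  rw [← Module.finrank_eq_rank, Cardinal.toENat_nat]
  exact_mod_cast LinearMap.finrank_le_finrank_of_injective hinj

/-- Comparison of indices: if from every negative definite subspace of `S` the common kernel of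
finitely many functionals embeds, as negative vectors, into `S'`, then the index on `S` exceeds
the one on `S'` by at most the number of functionals. -/
theorem negIndex_le_add {F X' : Type*} [AddCommGroup F] [Module ℝ F] [FiniteDimensional ℝ F]
    [AddCommGroup X'] [Module ℝ X'] {B : X → X → ℝ} {S : Set X} {B' : X' → X' → ℝ} {S' : Set X'}
    (T : X →ₗ[ℝ] X') (hfin : negIndex B S ≠ ⊤)
    (h : ∀ W : Submodule ℝ X, (W : Set X) ⊆ S → ∃ L : W →ₗ[ℝ] F, ∀ w : W, L w = 0 →
      T w ∈ S' ∧ (T w = 0 → (w : X) = 0) ∧ (B w w < 0 → B' (T w) (T w) < 0)) :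
    negIndex B S ≤ negIndex B' S' + Module.finrank ℝ F := by
  refine negIndex_le fun W hS hW ↦ ?_
  obtain ⟨L, hL⟩ := h W hS
  -- A finite index makes `W` finite-dimensional, so that dimensions can be counted by rank and
  -- nullity.
  have hWfin : FiniteDimensional ℝ W := by
    have h1 : Cardinal.toENat (Module.rank ℝ W) ≠ ⊤ := ne_top_of_le_ne_top hfin (le_negIndex hS hW)
    exact Module.rank_lt_aleph0_iff.1 (Cardinal.toENat_lt_top.1 (lt_top_iff_ne_top.2 h1))
  let T' : LinearMap.ker L →ₗ[ℝ] X' := T ∘ₗ W.subtype ∘ₗ (LinearMap.ker L).subtype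
  have hT' : Function.Injective T' := by
    refine (injective_iff_map_eq_zero T').2 fun w hw ↦ ?_
    exact Subtype.ext (Subtype.ext ((hL w.1 w.2).2.1 hw))
  have h1 : Cardinal.toENat (Module.rank ℝ (LinearMap.range T')) ≤ negIndex B' S' := by
    refine le_negIndex ?_ ?_
    · rintro _ ⟨w, rfl⟩
      exact (hL w.1 w.2).1
    · rintro _ ⟨w, rfl⟩ hne
      refine (hL w.1 w.2).2.2 (hW _ w.1.2 fun h0 ↦ hne ?_)
      have : w = 0 := Subtype.ext (Subtype.ext h0)
      rw [this, map_zero]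
  rw [← Module.finrank_eq_rank, Cardinal.toENat_nat] at h1 ⊢
  rw [LinearMap.finrank_range_of_inj hT'] at h1
  refine le_trans ?_ (add_le_add_left h1 _)
  have h2 := L.finrank_range_add_finrank_ker
  have h3 : Module.finrank ℝ (LinearMap.range L) ≤ Module.finrank ℝ F :=
    Submodule.finrank_le _
  exact_mod_cast (by omega : Module.finrank ℝ W ≤
    Module.finrank ℝ (LinearMap.ker L) + Module.finrank ℝ F)

/-- The plane spanned by `y` and `w` is negative definite. For a form of index one this excludes
negative vectors orthogonal to `y`. -/
theorem two_le_negIndex {B : X →ₗ[ℝ] X →ₗ[ℝ] ℝ} (hsymm : ∀ u v, B u v = B v u) {y w : X}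
    (hy : B y y < 0) (hw : B w w < 0) (hyw : B w y = 0) :
    2 ≤ negIndex (fun u v ↦ B u v) univ := by
  have hB : ∀ a c : ℝ, B (a • y + c • w) (a • y + c • w) = a ^ 2 * B y y + c ^ 2 * B w w := by
    intro a c
    simp only [map_add, map_smul, LinearMap.add_apply, LinearMap.smul_apply, smul_eq_mul, hyw,
      hsymm y w]
    ring
  have hlt : ∀ a c : ℝ, (a ≠ 0 ∨ c ≠ 0) → a ^ 2 * B y y + c ^ 2 * B w w < 0 := by
    intro a c hac
    rcases hac with ha | hc
    · nlinarith [mul_neg_of_pos_of_neg (pow_pos (abs_pos.2 ha) 2) hy, sq_abs a, sq_nonneg c]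
    · nlinarith [mul_neg_of_pos_of_neg (pow_pos (abs_pos.2 hc) 2) hw, sq_abs c, sq_nonneg a]
  have hli : LinearIndependent ℝ ![y, w] := by
    rw [LinearIndependent.pair_iff]
    intro a c h
    by_contra hne
    have := hlt a c (by tauto)
    rw [← hB, h] at this
    simp at this
  have hrank : Module.finrank ℝ (Submodule.span ℝ (range ![y, w])) = 2 := by
    rw [finrank_span_eq_card hli, Fintype.card_fin]
  have h := le_negIndex (B := fun u v ↦ B u v) (S := univ)
    (W := Submodule.span ℝ (range ![y, w])) (subset_univ _) (by
      intro v hv hne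
      rw [Matrix.range_cons, Matrix.range_cons, Matrix.range_empty, union_empty, singleton_union,
        Submodule.mem_span_pair] at hv
      obtain ⟨a, c, rfl⟩ := hv
      simp only [hB]
      refine hlt a c ?_
      by_contra! h0
      simp [h0.1, h0.2] at hne)
  have : FiniteDimensional ℝ (Submodule.span ℝ (range ![y, w])) :=
    FiniteDimensional.span_of_finite ℝ (finite_range _)
  rw [← Module.finrank_eq_rank, hrank, Cardinal.toENat_nat] at h
  exact_mod_cast h

/-- Reversing the sign of a Lorentzian form on a timelike vector gives a positive definite form. -/
theorem lorentz_reflection_pos {B : X →ₗ[ℝ] X →ₗ[ℝ] ℝ} (hsymm : ∀ u v, B u v = B v u)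
    (hnd : ∀ u, (∀ v, B u v = 0) → u = 0) (hind : negIndex (fun u v ↦ B u v) univ = 1) {y : X}
    (hy : B y y < 0) {u : X} (hu : u ≠ 0) : 0 < B u u - 2 / B y y * (B u y) ^ 2 := by
  have hpos : ∀ w, B w y = 0 → 0 ≤ B w w := by
    intro w hw
    by_contra! hlt
    have := two_le_negIndex hsymm hy hlt hw
    rw [hind] at this
    exact absurd this (by norm_num)
  have hpos' : ∀ w, w ≠ 0 → B w y = 0 → 0 < B w w := by
    intro w hne hw
    -- On the orthogonal complement of `y` the form is semidefinite, so a null vector there is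
    -- orthogonal to the whole complement. It is also orthogonal to `y`, hence it vanishes by
    -- nondegeneracy.
    refine lt_of_le_of_ne (hpos w hw) fun h0 ↦ hne (hnd w fun z ↦ ?_)
    by_contra hz
    set z' := z - (B z y / B y y) • y with hz'
    have h1 : B z' y = 0 := by
      simp [hz', hy.ne]
    have h2 : B w z' = B w z := by simp [hz', hw]
    -- If `B w z ≠ 0`, this coefficient of `w` gives the vector the value `-1`, contradicting
    -- `hpos`.
    have h3 := hpos (((-(B z' z' + 1)) / (2 * B w z)) • w + z') (by simp [hw, h1])
    simp only [map_add, map_smul, LinearMap.add_apply, LinearMap.smul_apply, smul_eq_mul, ← h0,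
      hsymm z' w, h2] at h3
    have h4 : (-(B z' z' + 1)) / (2 * B w z) * B w z = -(B z' z' + 1) / 2 := by
      field_simp
    linarith
  set a := B u y / B y y with ha
  have hay : B u y = a * B y y := by rw [ha, div_mul_cancel₀ _ hy.ne]
  set w := u - a • y with hw
  have hwy : B w y = 0 := by simp [hw, hay]
  have huw : u = w + a • y := by simp [hw]
  have h1 : B u u = B w w + a ^ 2 * B y y := by
    rw [huw]
    simp only [map_add, map_smul, LinearMap.add_apply, LinearMap.smul_apply, smul_eq_mul, hwy,
      hsymm y w]
    ring
  have h2 : B u u - 2 / B y y * (B u y) ^ 2 = B w w - a ^ 2 * B y y := by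
    rw [h1, hay]
    field_simp
    ring
  rw [h2]
  by_cases h0 : w = 0
  · have ha0 : a ≠ 0 := by
      rintro ha0
      rw [h0, ha0] at huw
      simp at huw
      exact hu huw
    rw [h0]
    simp only [map_zero]
    nlinarith [mul_neg_of_pos_of_neg (pow_pos (abs_pos.2 ha0) 2) hy, sq_abs a]
  · nlinarith [hpos' w h0 hwy, sq_nonneg a]

end NegIndex

/-! ### Pointwise estimates for the integrand of the index form -/

section Bounds

set_option maxSynthPendingDepth 3

variable {E : Type*} [NormedAddCommGroup E] [NormedSpace ℝ E]

theorem exists_coercive_bound [FiniteDimensional ℝ E] (H : E →L[ℝ] E →L[ℝ] ℝ)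
    (hH : ∀ u, u ≠ 0 → 0 < H u u) : ∃ c > 0, ∀ u, c * ‖u‖ ^ 2 ≤ H u u := by
  rcases subsingleton_or_nontrivial E with hE | hE
  · exact ⟨1, one_pos, fun u ↦ by simp [Subsingleton.elim u 0]⟩
  have hne : (Metric.sphere (0 : E) 1).Nonempty := NormedSpace.sphere_nonempty.2 zero_le_one
  obtain ⟨u₀, hu₀, hmin⟩ := (isCompact_sphere (0 : E) 1).exists_isMinOn hne
    (f := fun u ↦ H u u) (by fun_prop)
  have hu₀' : u₀ ≠ 0 := by
    rintro rfl
    simp at hu₀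
  refine ⟨H u₀ u₀, hH u₀ hu₀', fun u ↦ ?_⟩
  by_cases hu : u = 0
  · simp [hu]
  have hn : ‖u‖ ≠ 0 := norm_ne_zero_iff.2 hu
  have h1 : H u₀ u₀ ≤ H (‖u‖⁻¹ • u) (‖u‖⁻¹ • u) := hmin (by simp [norm_smul, hn])
  simp only [map_smul, smul_apply, smul_eq_mul] at h1
  have h2 : H u u = ‖u‖ ^ 2 * (‖u‖⁻¹ * (‖u‖⁻¹ * H u u)) := by field_simp
  rw [h2, mul_comm]
  gcongr

/-- The lower bound for the index form under the constraint, at one point. -/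
theorem quadratic_lower_bound {b : E →L[ℝ] E →L[ℝ] ℝ} {y z p x q : E} {c m β α ζ : ℝ}
    (hc : 0 < c) (hm : 0 < m) (hβ : ‖b‖ ≤ β) (hz : ‖z‖ ≤ ζ) (hq : ‖q‖ ≤ α * ‖x‖)
    (hy : b y y ≤ -m) (hpos : ∀ u, c * ‖u‖ ^ 2 ≤ b u u - 2 / b y y * (b u y) ^ 2)
    (hcon : b (p + q) y = b x z) :
    c / 2 * ‖p‖ ^ 2 - (c * α ^ 2 + 2 * (β * ζ) ^ 2 / m) * ‖x‖ ^ 2 ≤ b (p + q) (p + q) := by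
  -- In the application `b` is the metric, `y` and `z` are `Y` and `DY/dt`, `x` is the field, `p`
  -- its coordinate derivative and `q` the Christoffel term, so that `p + q` is the covariant
  -- derivative. By `hcon` the square of `b (p + q) y` is at most `(β ζ)² ‖x‖²`; the term `c α²` is
  -- the price of passing from `p + q` to `p`.
  have h1 := hpos (p + q)
  have h2 : ‖p‖ ≤ ‖p + q‖ + ‖q‖ := by
    simpa using norm_sub_le (p + q) q
  have h3 : ‖p‖ ^ 2 ≤ 2 * ‖p + q‖ ^ 2 + 2 * ‖q‖ ^ 2 := by
    nlinarith [norm_nonneg p, sq_nonneg (‖p + q‖ - ‖q‖)]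
  have h4 : ‖q‖ ^ 2 ≤ α ^ 2 * ‖x‖ ^ 2 := by
    rw [← mul_pow]
    gcongr
  have h5 : |b x z| ≤ β * ζ * ‖x‖ := by
    have hβ0 := (norm_nonneg b).trans hβ
    calc |b x z| ≤ ‖b‖ * ‖x‖ * ‖z‖ := b.le_opNorm₂ x z
      _ ≤ β * ‖x‖ * ζ := by gcongr
      _ = β * ζ * ‖x‖ := by ring
  have h6 : (b x z) ^ 2 ≤ (β * ζ) ^ 2 * ‖x‖ ^ 2 := by
    rw [← mul_pow, ← sq_abs]
    gcongr
  have h7 : -(2 / b y y) ≤ 2 / m := by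
    rw [← div_neg]
    exact div_le_div_of_nonneg_left (by norm_num) hm (by linarith)
  have h8 : -(2 / b y y * (b (p + q) y) ^ 2) ≤ 2 / m * ((β * ζ) ^ 2 * ‖x‖ ^ 2) := by
    rw [hcon, ← neg_mul]
    gcongr
  have h9 : 2 * (β * ζ) ^ 2 / m * ‖x‖ ^ 2 = 2 / m * ((β * ζ) ^ 2 * ‖x‖ ^ 2) := by ring
  rw [add_mul, h9]
  nlinarith

theorem norm_flatCurvature_le [CompleteSpace E] {G : E → E →L[ℝ] E →L[ℝ] ℝ} {y : E}
    (hG : ContDiffAt ℝ ∞ G y) (hi : (G y).IsInvertible) (u v w : E) :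
    ‖flatCurvature G y u v w‖ ≤
      (2 * ‖fderiv ℝ (christoffelCLM G) y‖ + 2 * ‖christoffelCLM G y‖ ^ 2) *
        (‖u‖ * ‖v‖ * ‖w‖) := by
  rw [flatCurvature, IsMetricPullback.fderiv_flatChristoffel hG hi,
    IsMetricPullback.fderiv_flatChristoffel hG hi]
  simp only [← christoffelCLM_apply]
  set D := fderiv ℝ (christoffelCLM G) y
  set Γ := christoffelCLM G y
  have hD : ∀ a b : E, ‖D a b w‖ ≤ ‖D‖ * ‖a‖ * ‖b‖ * ‖w‖ := fun a b ↦
    ((D a b).le_opNorm w).trans (by gcongr; exact D.le_opNorm₂ a b)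
  have hΓ : ∀ a b : E, ‖Γ a (Γ b w)‖ ≤ ‖Γ‖ * ‖a‖ * (‖Γ‖ * ‖b‖ * ‖w‖) := fun a b ↦
    (Γ.le_opNorm₂ a _).trans (by gcongr; exact Γ.le_opNorm₂ b w)
  calc ‖D u v w - D v u w + Γ u (Γ v w) - Γ v (Γ u w)‖
      ≤ ‖D u v w‖ + ‖D v u w‖ + ‖Γ u (Γ v w)‖ + ‖Γ v (Γ u w)‖ :=
        (norm_sub_le _ _).trans (by
          gcongr
          exact (norm_add_le _ _).trans (by gcongr; exact norm_sub_le _ _))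
    _ ≤ _ := by
        have := hD u v
        have := hD v u
        have := hΓ u v
        have := hΓ v u
        nlinarith

end Bounds

/-! ### The lower bound for the index form near a point of the curve -/

section LocalBound

open scoped Topology

set_option maxSynthPendingDepth 3

theorem ContDiffAt.continuousAt_deriv_infty {F : Type*} [NormedAddCommGroup F] [NormedSpace ℝ F]
    {f : ℝ → F} {t : ℝ} (hf : ContDiffAt ℝ ∞ f t) : ContinuousAt (deriv f) t := by
  have h : ContinuousAt (fun s ↦ fderiv ℝ f s 1) t :=
    (hf.fderiv_right (m := ∞) (by simp)).continuousAt.clm_apply continuousAt_const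
  simpa only [fderiv_apply_one_eq_deriv] using h

/-- The form `b` with the sign on the timelike vector `y` reversed. -/
def reflectedForm {E : Type*} [NormedAddCommGroup E] [NormedSpace ℝ E] (b : E →L[ℝ] E →L[ℝ] ℝ)
    (y : E) : E →L[ℝ] E →L[ℝ] ℝ :=
  b - (2 / b y y) • ContinuousLinearMap.smulRightL ℝ E (E →L[ℝ] ℝ)
    (ContinuousLinearMap.flipₗᵢ ℝ E E ℝ b y) (ContinuousLinearMap.flipₗᵢ ℝ E E ℝ b y)

theorem reflectedForm_apply {E : Type*} [NormedAddCommGroup E] [NormedSpace ℝ E]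
    (b : E →L[ℝ] E →L[ℝ] ℝ) (y u : E) :
    reflectedForm b y u u = b u u - 2 / b y y * (b u y) ^ 2 := by
  simp [reflectedForm, sq]

theorem ContinuousAt.reflectedForm {E : Type*} [NormedAddCommGroup E] [NormedSpace ℝ E]
    {b : ℝ → E →L[ℝ] E →L[ℝ] ℝ} {y : ℝ → E} {t : ℝ} (hb : ContinuousAt b t)
    (hy : ContinuousAt y t) (h0 : b t (y t) (y t) ≠ 0) :
    ContinuousAt (fun s ↦ reflectedForm (b s) (y s)) t := by
  have h1 : ContinuousAt (fun s ↦ ContinuousLinearMap.flipₗᵢ ℝ E E ℝ (b s) (y s)) t :=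
    (((ContinuousLinearMap.flipₗᵢ ℝ E E ℝ).continuous.continuousAt).comp hb).clm_apply hy
  have h2 : ContinuousAt (fun s ↦ b s (y s) (y s)) t := (hb.clm_apply hy).clm_apply hy
  exact hb.sub ((continuousAt_const.div h2 h0).smul
    ((((ContinuousLinearMap.smulRightL ℝ E (E →L[ℝ] ℝ)).continuous.continuousAt).comp
      h1).clm_apply h1))

variable {n : ℕ} {M : Type*} [TopologicalSpace M] [ChartedSpace (EuclideanSpace ℝ (Fin n)) M]
  [IsManifold (𝓡 n) ∞ M]

theorem metricAt_eq_chartMetric_self (g : LorentzMetric n M) (p : M)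
    (u v : EuclideanSpace ℝ (Fin n)) :
    chartMetric g p (extChartAt (𝓡 n) p p) u v = metricAt g p u v := by
  have hp := mem_extChartAt_source (I := 𝓡 n) p
  rw [metricAt_eq_chartMetric g hp, tangentCoordChange_self hp, tangentCoordChange_self hp]

theorem metricAt_reflection_pos (g : LorentzMetric n M) (p : M) {y u : EuclideanSpace ℝ (Fin n)}
    (hy : metricAt g p y y < 0) (hu : u ≠ 0) :
    0 < metricAt g p u u - 2 / metricAt g p y y * (metricAt g p u y) ^ 2 := by
  let B : EuclideanSpace ℝ (Fin n) →ₗ[ℝ] EuclideanSpace ℝ (Fin n) →ₗ[ℝ] ℝ :=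
    LinearMap.mk₂ ℝ (fun u v ↦ metricAt g p u v) (by simp) (by simp) (by simp) (by simp)
  exact lorentz_reflection_pos (B := B) (fun u v ↦ g.symm p u v) (fun u hu ↦ g.nondegenerate p u hu)
    (g.index_eq_one p) hy hu

/-- Near each point of a curve, the index form controls the derivative of the fields that satisfy
the homogeneous constraint. -/
theorem exists_local_lower_bound (g : LorentzMetric n M) {Y : (p : M) → TangentSpace (𝓡 n) p}
    (hY : IsTimelikeKilling g Y) {γ : ℝ → M} (hγ : ContMDiff 𝓘(ℝ, ℝ) (𝓡 n) ∞ γ) (τ : ℝ) :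
    ∃ c > 0, ∃ K : ℝ, ∀ᶠ t in 𝓝 τ, γ t ∈ (extChartAt (𝓡 n) (γ τ)).source ∧
      ∀ V : ℝ → EuclideanSpace ℝ (Fin n), DifferentiableAt ℝ (chartField γ V (γ τ)) t →
        constraintDensity g Y γ V t = 0 →
        c * ‖deriv (chartField γ V (γ τ)) t‖ ^ 2 - K * ‖chartField γ V (γ τ) t‖ ^ 2 ≤
          indexDensity g γ V t := by
  set x₀ := γ τ with hx₀
  have hs := mem_extChartAt_source (I := 𝓡 n) x₀
  set cv := chartCurve n γ x₀ with hcv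
  set Yc := chartField γ (fun s ↦ Y (γ s)) x₀ with hYc
  have hcvs : ContDiffAt ℝ ∞ cv τ := contDiffAt_chartCurve hγ hs
  have hYcs : ContDiffAt ℝ ∞ Yc τ := contDiffAt_chartField_vectorField hY.contMDiff hγ τ
  have htgt : cv τ ∈ (extChartAt (𝓡 n) x₀).target := (extChartAt (𝓡 n) x₀).map_source hs
  have hGs : ContDiffAt ℝ ∞ (chartMetric g x₀) (cv τ) :=
    (g.smooth x₀).contDiffAt ((isOpen_extChartAt_target (I := 𝓡 n) x₀).mem_nhds htgt)
  have hΓs := contDiffAt_christoffelCLM hGs (chartMetric_isInvertible g x₀ htgt)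
  have hG : ContinuousAt (fun t ↦ chartMetric g x₀ (cv t)) τ :=
    ContinuousAt.comp (f := cv) hGs.continuousAt hcvs.continuousAt
  have hΓ : ContinuousAt (fun t ↦ christoffelCLM (chartMetric g x₀) (cv t)) τ :=
    ContinuousAt.comp (f := cv) hΓs.continuousAt hcvs.continuousAt
  have hD : ContinuousAt (fun t ↦ fderiv ℝ (christoffelCLM (chartMetric g x₀)) (cv t)) τ :=
    ContinuousAt.comp (f := cv) (hΓs.fderiv_right (m := ∞) (by simp)).continuousAt
      hcvs.continuousAt
  have hcv' : ContinuousAt (deriv cv) τ := hcvs.continuousAt_deriv_infty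
  have hA := hΓ.clm_apply hcv'
  set Zc := chartCovDeriv g γ x₀ Yc with hZc
  have hZ : ContinuousAt Zc τ := by
    have h := hYcs.continuousAt_deriv_infty.add (hA.clm_apply hYcs.continuousAt)
    simp only [christoffelCLM_apply] at h
    exact h
  have hYτ : Yc τ = Y x₀ := chartField_self γ (fun s ↦ Y (γ s)) τ
  have hGτ : ∀ u v, chartMetric g x₀ (cv τ) u v = metricAt g x₀ u v :=
    metricAt_eq_chartMetric_self g x₀
  have hneg : metricAt g x₀ (Y x₀) (Y x₀) < 0 := hY.timelike x₀
  have hneg' : chartMetric g x₀ (cv τ) (Yc τ) (Yc τ) < 0 := by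
    rw [hGτ, hYτ]; exact hneg
  obtain ⟨c, hc, hcpos⟩ := exists_coercive_bound
    (reflectedForm (chartMetric g x₀ (cv τ)) (Yc τ)) (by
      intro u hu
      rw [reflectedForm_apply, hGτ, hGτ, hGτ, hYτ]
      exact metricAt_reflection_pos g x₀ hneg hu)
  have hH := hG.reflectedForm hYcs.continuousAt hneg'.ne
  have hYY := (hG.clm_apply hYcs.continuousAt).clm_apply hYcs.continuousAt
  have hρ : ContinuousAt (fun t ↦ ‖chartMetric g x₀ (cv t)‖ *
      ((2 * ‖fderiv ℝ (christoffelCLM (chartMetric g x₀)) (cv t)‖ +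
        2 * ‖christoffelCLM (chartMetric g x₀) (cv t)‖ ^ 2) *
      (‖deriv cv t‖ * ‖deriv cv t‖))) τ :=
    hG.norm.mul (((continuousAt_const.mul hD.norm).add
      (continuousAt_const.mul (hΓ.norm.pow 2))).mul (hcv'.norm.mul hcv'.norm))
  set m := -(chartMetric g x₀ (cv τ) (Yc τ) (Yc τ)) / 2 with hm
  have hmpos : 0 < m := by rw [hm]; linarith
  set β := ‖chartMetric g x₀ (cv τ)‖ + 1 with hβ
  set ζ := ‖Zc τ‖ + 1 with hζ
  set α := ‖christoffelCLM (chartMetric g x₀) (cv τ) (deriv cv τ)‖ + 1 with hα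
  set ρ := ‖chartMetric g x₀ (cv τ)‖ *
      ((2 * ‖fderiv ℝ (christoffelCLM (chartMetric g x₀)) (cv τ)‖ +
        2 * ‖christoffelCLM (chartMetric g x₀) (cv τ)‖ ^ 2) *
      (‖deriv cv τ‖ * ‖deriv cv τ‖)) + 1 with hρdef
  -- One half is lost in carrying coercivity from `τ` to nearby times, the other in
  -- `quadratic_lower_bound`; `ρ` bounds the curvature term. All constants, and the neighborhood of
  -- `τ`, are chosen before the field `V`.
  refine ⟨c / 2 / 2, by positivity, c / 2 * α ^ 2 + 2 * (β * ζ) ^ 2 / m + ρ, ?_⟩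
  have eS := eventually_mem_source hγ.continuous.continuousAt hs
  have eY : ∀ᶠ t in 𝓝 τ, DifferentiableAt ℝ Yc t := by
    have := (hYcs.of_le (m := 1) (by exact_mod_cast le_top)).eventually (by simp)
    filter_upwards [this] with t ht using ht.differentiableAt (by simp)
  have e1 := hG.norm.eventually_lt continuousAt_const (lt_add_one ‖chartMetric g x₀ (cv τ)‖)
  have e2 := hZ.norm.eventually_lt continuousAt_const (lt_add_one ‖Zc τ‖)
  have e3 := hA.norm.eventually_lt continuousAt_const
    (lt_add_one ‖christoffelCLM (chartMetric g x₀) (cv τ) (deriv cv τ)‖)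
  have e4 := hρ.eventually_lt continuousAt_const (lt_add_one _)
  have e5 := hYY.eventually_lt (g := fun _ ↦ -m) continuousAt_const (by rw [hm]; linarith)
  have e6 := (hH.sub (continuousAt_const (y :=
    reflectedForm (chartMetric g x₀ (cv τ)) (Yc τ)))).norm.eventually_lt
    (g := fun _ ↦ c / 2) continuousAt_const (by simpa using hc)
  filter_upwards [eS, eY, e1, e2, e3, e4, e5, e6] with t hS hYd h1 h2 h3 h4 h5 h6
  refine ⟨hS, fun V hV hcon ↦ ?_⟩
  set f := chartField γ V x₀ with hf
  rw [constraintDensity_eq g hγ hS hV hYd, sub_eq_zero] at hcon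
  rw [indexDensity_eq g hγ hS hV]
  have htt : cv t ∈ (extChartAt (𝓡 n) x₀).target := (extChartAt (𝓡 n) x₀).map_source hS
  have hGst : ContDiffAt ℝ ∞ (chartMetric g x₀) (cv t) :=
    (g.smooth x₀).contDiffAt ((isOpen_extChartAt_target (I := 𝓡 n) x₀).mem_nhds htt)
  have hpos : ∀ u, c / 2 * ‖u‖ ^ 2 ≤ chartMetric g x₀ (cv t) u u -
      2 / chartMetric g x₀ (cv t) (Yc t) (Yc t) * (chartMetric g x₀ (cv t) u (Yc t)) ^ 2 := by
    intro u
    rw [← reflectedForm_apply]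
    have k1 := hcpos u
    have k2 := (reflectedForm (chartMetric g x₀ (cv t)) (Yc t) -
      reflectedForm (chartMetric g x₀ (cv τ)) (Yc τ)).le_opNorm₂ u u
    rw [Real.norm_eq_abs] at k2
    have k3 := (abs_le.1 k2).1
    have k4 : ‖reflectedForm (chartMetric g x₀ (cv t)) (Yc t) -
      reflectedForm (chartMetric g x₀ (cv τ)) (Yc τ)‖ * ‖u‖ * ‖u‖ ≤ c / 2 * ‖u‖ * ‖u‖ := by
      gcongr
      exact h6.le
    simp only [sub_apply] at k3
    nlinarith
  have hq : ‖christoffel g x₀ (cv t) (deriv cv t) (f t)‖ ≤ α * ‖f t‖ := by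
    rw [christoffel_eq_flatChristoffel, ← christoffelCLM_apply]
    exact (ContinuousLinearMap.le_opNorm _ _).trans (by gcongr)
  have hQ := quadratic_lower_bound (b := chartMetric g x₀ (cv t)) (y := Yc t) (z := Zc t)
    (p := deriv f t) (x := f t) (q := christoffel g x₀ (cv t) (deriv cv t) (f t))
    (half_pos hc) hmpos h1.le h2.le hq h5.le hpos hcon
  have hR : |chartMetric g x₀ (cv t) (chartCurvature g x₀ (cv t) (deriv cv t) (f t)
      (deriv cv t)) (f t)| ≤ ρ * ‖f t‖ ^ 2 := by
    have k1 := norm_flatCurvature_le hGst (chartMetric_isInvertible g x₀ htt) (deriv cv t) (f t)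
      (deriv cv t)
    refine ((chartMetric g x₀ (cv t)).le_opNorm₂ _ _).trans ?_
    rw [chartCurvature_eq_flatCurvature]
    calc _ ≤ ‖chartMetric g x₀ (cv t)‖ *
          ((2 * ‖fderiv ℝ (christoffelCLM (chartMetric g x₀)) (cv t)‖ +
          2 * ‖christoffelCLM (chartMetric g x₀) (cv t)‖ ^ 2) *
          (‖deriv cv t‖ * ‖f t‖ * ‖deriv cv t‖)) * ‖f t‖ := by gcongr
      _ = ‖chartMetric g x₀ (cv t)‖ *
          ((2 * ‖fderiv ℝ (christoffelCLM (chartMetric g x₀)) (cv t)‖ +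
          2 * ‖christoffelCLM (chartMetric g x₀) (cv t)‖ ^ 2) *
          (‖deriv cv t‖ * ‖deriv cv t‖)) * ‖f t‖ ^ 2 := by ring
      _ ≤ ρ * ‖f t‖ ^ 2 := by gcongr
  have hR' := (abs_le.1 hR).1
  have e : chartCovDeriv g γ x₀ f t =
    deriv f t + christoffel g x₀ (cv t) (deriv cv t) (f t) := rfl
  rw [e]
  linarith

end LocalBound

/-! ### Absolute continuity of Sobolev functions and the Poincaré argument -/

section AbsoluteContinuity

open scoped Topology

/-- Compactness of `[a, b]`, as in the Lebesgue number lemma: what holds on all short intervals near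
each point holds on all the pieces of some finite partition. -/
theorem exists_adapted_partition {a b : ℝ} (hab : a ≤ b) {P : ℝ → ℝ → Prop}
    (h : ∀ x ∈ Icc a b, ∃ δ > 0, ∀ s t, x - δ < s → s ≤ t → t < x + δ → P s t) :
    ∃ (t : ℕ → ℝ) (m : ℕ), t 0 = a ∧ t m = b ∧ Monotone t ∧ (∀ k, t k ∈ Icc a b) ∧
      ∀ k, P (t k) (t (k + 1)) := by
  choose! δ hδ hP using h
  let c : Icc a b → Set (Icc a b) := fun x ↦ Subtype.val ⁻¹' Ioo (x.1 - δ x.1) (x.1 + δ x.1)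
  obtain ⟨t, h0, hmono, ⟨m, hm⟩, hc⟩ := exists_monotone_Icc_subset_open_cover_Icc hab (c := c)
    (fun x ↦ isOpen_Ioo.preimage continuous_subtype_val)
    (fun x _ ↦ mem_iUnion.2 ⟨x, by
      have := hδ x.1 x.2
      constructor <;> linarith⟩)
  refine ⟨fun k ↦ t k, m, h0, hm m le_rfl, fun i j hij ↦ hmono hij, fun k ↦ (t k).2, fun k ↦ ?_⟩
  obtain ⟨x, hx⟩ := hc k
  have h1 : (t k : ℝ) ≤ t (k + 1) := hmono (Nat.le_succ k)
  have h2 := hx (left_mem_Icc.2 (hmono (Nat.le_succ k)))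
  have h3 := hx (right_mem_Icc.2 (hmono (Nat.le_succ k)))
  exact hP x.1 x.2 _ _ h2.1 h1 h3.2

theorem integral_deriv_eq_sub_of_locally {f : ℝ → ℝ} {a b : ℝ} (hab : a ≤ b)
    (h : ∀ x ∈ Icc a b, ∃ δ > 0, AbsolutelyContinuousOnInterval f (x - δ) (x + δ)) :
    IntervalIntegrable (deriv f) volume a b ∧ ∫ s in a..b, deriv f s = f b - f a := by
  obtain ⟨t, m, h0, hm, -, -, hP⟩ := exists_adapted_partition hab
    (P := fun s t ↦ AbsolutelyContinuousOnInterval f s t) (by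
      intro x hx
      obtain ⟨δ, hδ, hf⟩ := h x hx
      refine ⟨δ, hδ, fun s t h1 h2 h3 ↦ hf.mono ?_⟩
      rw [uIcc_of_le h2, uIcc_of_le (by linarith)]
      exact Icc_subset_Icc h1.le h3.le)
  constructor
  · rw [← h0, ← hm]
    exact IntervalIntegrable.trans_iterate fun k _ ↦ (hP k).intervalIntegrable_deriv
  · rw [← h0, ← hm, ← intervalIntegral.sum_integral_adjacent_intervals
      fun k _ ↦ (hP k).intervalIntegrable_deriv]
    rw [Finset.sum_congr rfl fun k _ ↦ (hP k).integral_deriv_eq_sub]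
    exact Finset.sum_range_sub (fun k ↦ f (t k)) m

theorem AbsolutelyContinuousOnInterval.congr_on {X : Type*} [PseudoMetricSpace X] {f f' : ℝ → X}
    {a b : ℝ} (hf : AbsolutelyContinuousOnInterval f a b) (h : EqOn f f' (uIcc a b)) :
    AbsolutelyContinuousOnInterval f' a b := by
  rw [absolutelyContinuousOnInterval_iff] at hf ⊢
  intro ε hε
  obtain ⟨δ, hδ, hd⟩ := hf ε hε
  refine ⟨δ, hδ, fun I hI hlt ↦ ?_⟩
  convert hd I hI hlt using 1
  refine Finset.sum_congr rfl fun i hi ↦ ?_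
  rw [h (hI.1 i hi).1, h (hI.1 i hi).2]

variable {n : ℕ}

/-- The components of `f` are absolutely continuous near `t`. -/
def LocallyACAt (f : ℝ → EuclideanSpace ℝ (Fin n)) (t : ℝ) : Prop :=
  ∃ δ > 0, ∀ i, AbsolutelyContinuousOnInterval (fun s ↦ f s i) (t - δ) (t + δ)

theorem IsSobolevH1On.intervalIntegrable {u : ℝ → EuclideanSpace ℝ (Fin n)} {a b : ℝ}
    (hab : a ≤ b) (hu : MemLp u 2 (volume.restrict (Icc a b))) :
    IntervalIntegrable u volume a b := by
  rw [intervalIntegrable_iff_integrableOn_Icc_of_le hab]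
  exact hu.integrable (by norm_num)

theorem IsSobolevH1On.absolutelyContinuous {f : ℝ → EuclideanSpace ℝ (Fin n)} {a b : ℝ}
    (hab : a ≤ b) (hf : IsSobolevH1On f a b) (i : Fin n) :
    AbsolutelyContinuousOnInterval (fun s ↦ f s i) a b := by
  obtain ⟨u, hu, hfu⟩ := hf
  have hint := IsSobolevH1On.intervalIntegrable hab hu
  have hinti : IntervalIntegrable (fun s ↦ u s i) volume a b :=
    ⟨(EuclideanSpace.proj (𝕜 := ℝ) i).integrable_comp hint.1,
      (EuclideanSpace.proj (𝕜 := ℝ) i).integrable_comp hint.2⟩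
  have hconst : AbsolutelyContinuousOnInterval (fun _ : ℝ ↦ f a i) a b :=
    contDiffOn_const.absolutelyContinuousOnInterval
  refine (hconst.fun_add
    (hinti.absolutelyContinuousOnInterval_intervalIntegral left_mem_uIcc)).congr_on ?_
  intro t ht
  rw [uIcc_of_le hab] at ht
  have hint' : IntervalIntegrable u volume a t :=
    hint.mono_set (by
      rw [uIcc_of_le hab, uIcc_of_le ht.1]
      exact Icc_subset_Icc le_rfl ht.2)
  have h1 := (EuclideanSpace.proj (𝕜 := ℝ) i).intervalIntegral_comp_comm hint'
  have h2 := congrArg (fun v : EuclideanSpace ℝ (Fin n) ↦ v i) (hfu t ht)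
  simp only [PiLp.add_apply] at h2
  simp only [EuclideanSpace.coe_proj] at h1
  simp only [h1, h2]

theorem LocallyACAt.of_sobolev {f : ℝ → EuclideanSpace ℝ (Fin n)} {t δ : ℝ} (hδ : 0 < δ)
    (hf : IsSobolevH1On f (t - δ) (t + δ)) : LocallyACAt f t :=
  ⟨δ, hδ, hf.absolutelyContinuous (by linarith)⟩

theorem LocallyACAt.ae_differentiableAt {f : ℝ → EuclideanSpace ℝ (Fin n)} {t : ℝ}
    (hf : LocallyACAt f t) :
    ∃ U ∈ 𝓝 t, ∀ᵐ s, s ∈ U → DifferentiableAt ℝ f s := by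
  obtain ⟨δ, hδ, h⟩ := hf
  refine ⟨Icc (t - δ) (t + δ), Icc_mem_nhds (by linarith) (by linarith), ?_⟩
  filter_upwards [ae_all_iff.2 fun i ↦ (h i).ae_differentiableAt] with s hs hsU
  rw [differentiableAt_euclidean]
  exact fun i ↦ hs i (by rwa [uIcc_of_le (by linarith)])

/-- Local absolute continuity is preserved by smooth linear coordinate changes. -/
theorem LocallyACAt.clm_apply {f f' : ℝ → EuclideanSpace ℝ (Fin n)}
    {A : ℝ → EuclideanSpace ℝ (Fin n) →L[ℝ] EuclideanSpace ℝ (Fin n)} {t : ℝ}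
    (hf : LocallyACAt f t) (hA : ContDiffAt ℝ ∞ A t) (h : ∀ᶠ s in 𝓝 t, f' s = A s (f s)) :
    LocallyACAt f' t := by
  obtain ⟨δ₀, hδ₀, hac⟩ := hf
  have hA1 : ∀ᶠ s in 𝓝 t, ContDiffAt ℝ 1 A s :=
    (hA.of_le (m := 1) (by exact_mod_cast le_top)).eventually (by simp)
  obtain ⟨δ₁, hδ₁, hball⟩ := Metric.eventually_nhds_iff_ball.1 (h.and hA1)
  set δ := min δ₀ (δ₁ / 2) with hδ
  have hδpos : 0 < δ := lt_min hδ₀ (half_pos hδ₁)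
  have hδ1 : δ ≤ δ₀ := min_le_left _ _
  have hδ2 : δ < δ₁ := (min_le_right _ _).trans_lt (half_lt_self hδ₁)
  have hsub : ∀ s ∈ uIcc (t - δ) (t + δ), s ∈ Metric.ball t δ₁ := by
    intro s hs
    rw [uIcc_of_le (by linarith)] at hs
    rw [Metric.mem_ball, Real.dist_eq, abs_lt]
    constructor <;> linarith [hs.1, hs.2]
  refine ⟨δ, hδpos, fun i ↦ ?_⟩
  have hterm : ∀ j, AbsolutelyContinuousOnInterval
      (fun s ↦ A s (EuclideanSpace.single j 1) i * f s j) (t - δ) (t + δ) := by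
    intro j
    refine AbsolutelyContinuousOnInterval.fun_mul ?_ ((hac j).mono ?_)
    · refine ContDiffOn.absolutelyContinuousOnInterval fun s hs ↦ ContDiffAt.contDiffWithinAt ?_
      have h1 := (hball s (hsub s hs)).2
      have h2 : ContDiffAt ℝ 1 (fun r ↦ A r (EuclideanSpace.single j 1)) s :=
        h1.clm_apply contDiffAt_const
      exact (EuclideanSpace.proj (𝕜 := ℝ) i).contDiff.contDiffAt.comp s h2
    · rw [uIcc_of_le (by linarith), uIcc_of_le (by linarith)]
      exact Icc_subset_Icc (by linarith) (by linarith)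
  have hsum : ∀ S : Finset (Fin n), AbsolutelyContinuousOnInterval
      (fun s ↦ ∑ j ∈ S, A s (EuclideanSpace.single j 1) i * f s j) (t - δ) (t + δ) := by
    intro S
    induction S using Finset.induction_on with
    | empty =>
      simp only [Finset.sum_empty]
      exact contDiffOn_const.absolutelyContinuousOnInterval
    | insert j S hj ih =>
      simp only [Finset.sum_insert hj]
      exact (hterm j).fun_add ih
  refine (hsum Finset.univ).congr_on fun s hs ↦ ?_
  rw [(hball s (hsub s hs)).1]
  have hx : f s = ∑ j, f s j • EuclideanSpace.single j (1 : ℝ) := by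
    ext k
    simp [Finset.sum_apply, Pi.single_apply]
  conv_rhs => rw [hx]
  simp [map_sum, mul_comm]

/-- The fundamental theorem of calculus, component by component. Since `f` is differentiable almost
everywhere, the components of its derivative are almost everywhere the derivatives of its
components. -/
theorem integral_deriv_eq_sub_of_locallyACAt {f : ℝ → EuclideanSpace ℝ (Fin n)} {a b : ℝ}
    (hab : a ≤ b) (h : ∀ x ∈ Icc a b, LocallyACAt f x) :
    IntervalIntegrable (deriv f) volume a b ∧ ∫ s in a..b, deriv f s = f b - f a := by
  have hi : ∀ i, IntervalIntegrable (deriv fun s ↦ f s i) volume a b ∧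
      ∫ s in a..b, deriv (fun s ↦ f s i) s = f b i - f a i := fun i ↦
    integral_deriv_eq_sub_of_locally hab fun x hx ↦ by
      obtain ⟨δ, hδ, hac⟩ := h x hx
      exact ⟨δ, hδ, hac i⟩
  have hdiff : ∀ᵐ s, s ∈ Icc a b → DifferentiableAt ℝ f s := by
    rw [ae_iff]
    refine measure_null_of_locally_null _ fun s hs ↦ ?_
    have hs' : s ∈ Icc a b := by
      by_contra hn
      exact hs fun h' ↦ absurd h' hn
    obtain ⟨U, hU, hUd⟩ := (h s hs').ae_differentiableAt
    refine ⟨U ∩ {s | ¬(s ∈ Icc a b → DifferentiableAt ℝ f s)},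
      Filter.inter_mem (mem_nhdsWithin_of_mem_nhds hU) self_mem_nhdsWithin, ?_⟩
    refine measure_mono_null ?_ (ae_iff.1 hUd)
    rintro r ⟨hrU, hr⟩ h'
    exact hr fun _ ↦ h' hrU
  have hderiv : ∀ᵐ s, s ∈ Icc a b → ∀ i, deriv f s i = deriv (fun r ↦ f r i) s := by
    filter_upwards [hdiff] with s hs hsab i
    exact (((EuclideanSpace.proj (𝕜 := ℝ) i).hasFDerivAt.comp_hasDerivAt s
      (hs hsab).hasDerivAt).deriv).symm
  have hint : IntervalIntegrable (deriv f) volume a b := by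
    rw [intervalIntegrable_iff_integrableOn_Icc_of_le hab]
    have h1 : IntegrableOn (fun s ↦ WithLp.toLp 2 fun i ↦ deriv (fun r ↦ f r i) s) (Icc a b)
        volume := by
      have h2 : Integrable (fun s ↦ fun i ↦ deriv (fun r ↦ f r i) s)
          (volume.restrict (Icc a b)) := Integrable.of_eval fun i ↦
        (intervalIntegrable_iff_integrableOn_Icc_of_le hab).1 (hi i).1
      exact (PiLp.continuousLinearEquiv 2 ℝ
        (fun _ : Fin n ↦ ℝ)).symm.toContinuousLinearMap.integrable_comp h2
    refine h1.congr ?_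
    filter_upwards [ae_restrict_of_ae hderiv, ae_restrict_mem measurableSet_Icc] with s hs hsab
    ext i
    exact (hs hsab i).symm
  refine ⟨hint, ?_⟩
  ext i
  have h1 := (EuclideanSpace.proj (𝕜 := ℝ) i).intervalIntegral_comp_comm hint
  simp only [EuclideanSpace.coe_proj] at h1
  rw [← h1, PiLp.sub_apply, ← (hi i).2]
  refine intervalIntegral.integral_congr_ae ?_
  filter_upwards [hderiv] with s hs hsab
  rw [uIoc_of_le hab] at hsab
  exact hs (Ioc_subset_Icc_self hsab) i

theorem LocallyACAt.continuousAt {f : ℝ → EuclideanSpace ℝ (Fin n)} {t : ℝ}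
    (hf : LocallyACAt f t) : ContinuousAt f t := by
  obtain ⟨δ, hδ, h⟩ := hf
  have h1 : ∀ i, ContinuousAt (fun s ↦ f s i) t := fun i ↦
    (h i).continuousOn.continuousAt (by
      rw [uIcc_of_le (by linarith)]
      exact Icc_mem_nhds (by linarith) (by linarith))
  have h2 : ContinuousAt (fun s ↦ WithLp.toLp 2 fun i ↦ f s i) t :=
    (PiLp.continuous_toLp 2 (fun _ : Fin n ↦ ℝ)).continuousAt.comp (continuousAt_pi.2 h1)
  exact h2

/-- The square of the mean is at most the mean of the square. -/
theorem sq_integral_le {φ : ℝ → ℝ} {a b : ℝ} (hab : a ≤ b)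
    (h1 : IntervalIntegrable φ volume a b) (h2 : IntervalIntegrable (fun s ↦ φ s ^ 2) volume a b) :
    (∫ s in a..b, φ s) ^ 2 ≤ (b - a) * ∫ s in a..b, φ s ^ 2 := by
  rcases hab.eq_or_lt with rfl | hlt
  · simp
  set m := (∫ s in a..b, φ s) with hm
  -- Up to a factor this is the variance of `φ`, and its nonnegativity is the claim.
  have h3 : 0 ≤ ∫ s in a..b, ((b - a) * φ s - m) ^ 2 :=
    intervalIntegral.integral_nonneg hab fun s _ ↦ sq_nonneg _
  have h4 : ∫ s in a..b, ((b - a) * φ s - m) ^ 2 =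
      (b - a) ^ 2 * (∫ s in a..b, φ s ^ 2) - (b - a) * m ^ 2 := by
    have e : (fun s ↦ ((b - a) * φ s - m) ^ 2) =
      fun s ↦ (b - a) ^ 2 * φ s ^ 2 - 2 * (b - a) * m * φ s + m ^ 2 := by
      ext s; ring
    rw [e, intervalIntegral.integral_add ((h2.const_mul _).sub (h1.const_mul _))
      intervalIntegrable_const, intervalIntegral.integral_sub (h2.const_mul _) (h1.const_mul _),
      intervalIntegral.integral_const_mul, intervalIntegral.integral_const_mul,
      intervalIntegral.integral_const, ← hm, smul_eq_mul]
    ring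
  rw [h4] at h3
  have h5 : 0 < b - a := sub_pos.2 hlt
  have h6 : 0 ≤ (b - a) * ((b - a) * (∫ s in a..b, φ s ^ 2) - m ^ 2) := by linarith
  linarith [nonneg_of_mul_nonneg_right h6 h5]

/-- On short intervals, a form that controls the derivative is nonnegative on the functions that
vanish at the initial point. -/
theorem integral_nonneg_of_lower_bound {f : ℝ → EuclideanSpace ℝ (Fin n)} {q : ℝ → ℝ}
    {a b c K : ℝ} (hab : a ≤ b) (h : ∀ x ∈ Icc a b, LocallyACAt f x) (hfa : f a = 0)
    (hc : 0 < c) (hK : 0 ≤ K) (hKc : K * (b - a) ^ 2 ≤ c)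
    (hq : IntervalIntegrable q volume a b)
    (hle : ∀ᵐ t, t ∈ Icc a b → c * ‖deriv f t‖ ^ 2 - K * ‖f t‖ ^ 2 ≤ q t) :
    0 ≤ ∫ t in a..b, q t := by
  have hint := (integral_deriv_eq_sub_of_locallyACAt hab h).1
  have hcont : ContinuousOn f (Icc a b) := fun x hx ↦ (h x hx).continuousAt.continuousWithinAt
  have hf2 : IntervalIntegrable (fun t ↦ ‖f t‖ ^ 2) volume a b :=
    ContinuousOn.intervalIntegrable (by rw [uIcc_of_le hab]; exact hcont.norm.pow 2)
  -- Square integrability of the derivative is not assumed: the lower bound dominates its square by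
  -- `(q + K ‖f‖²) / c`.
  have hd2 : IntervalIntegrable (fun t ↦ ‖deriv f t‖ ^ 2) volume a b := by
    rw [intervalIntegrable_iff_integrableOn_Icc_of_le hab] at hint hq hf2 ⊢
    refine Integrable.mono' ((hq.add (hf2.const_mul K)).const_mul c⁻¹)
      (hint.aestronglyMeasurable.norm.pow 2) ?_
    filter_upwards [ae_restrict_of_ae hle, ae_restrict_mem measurableSet_Icc] with t ht htab
    rw [Real.norm_of_nonneg (sq_nonneg _), inv_mul_eq_div, le_div_iff₀ hc]
    have := ht htab
    simp only [Pi.add_apply]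
    linarith
  set D := ∫ t in a..b, ‖deriv f t‖ ^ 2 with hD
  have hD0 : 0 ≤ D := intervalIntegral.integral_nonneg hab fun t _ ↦ sq_nonneg _
  -- The Poincaré inequality: as `f a = 0`, the value `f t` is the integral of the derivative from
  -- `a` to `t`.
  have hpt : ∀ t ∈ Icc a b, ‖f t‖ ^ 2 ≤ (b - a) * D := by
    intro t ht
    have h1 := integral_deriv_eq_sub_of_locallyACAt ht.1 fun x hx ↦ h x ⟨hx.1, hx.2.trans ht.2⟩
    rw [hfa, sub_zero] at h1
    have h2 : ‖f t‖ ≤ ∫ s in a..b, ‖deriv f s‖ := by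
      rw [← h1.2]
      refine (intervalIntegral.norm_integral_le_integral_norm ht.1).trans ?_
      exact intervalIntegral.integral_mono_interval le_rfl ht.1 ht.2
        (Filter.Eventually.of_forall fun s ↦ norm_nonneg _) hint.norm
    calc ‖f t‖ ^ 2 ≤ (∫ s in a..b, ‖deriv f s‖) ^ 2 := by gcongr
      _ ≤ (b - a) * D := sq_integral_le hab hint.norm hd2
  have hf2le : ∫ t in a..b, ‖f t‖ ^ 2 ≤ (b - a) ^ 2 * D := by
    have := intervalIntegral.integral_mono_on hab hf2 intervalIntegrable_const hpt
    rw [intervalIntegral.integral_const, smul_eq_mul] at this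
    linarith
  have hmono : ∫ t in a..b, (c * ‖deriv f t‖ ^ 2 - K * ‖f t‖ ^ 2) ≤ ∫ t in a..b, q t := by
    refine intervalIntegral.integral_mono_ae_restrict hab
      ((hd2.const_mul c).sub (hf2.const_mul K)) hq ?_
    filter_upwards [ae_restrict_of_ae hle, ae_restrict_mem measurableSet_Icc] with t ht htab
    exact ht htab
  rw [intervalIntegral.integral_sub (hd2.const_mul c) (hf2.const_mul K),
    intervalIntegral.integral_const_mul, intervalIntegral.integral_const_mul, ← hD] at hmono
  have h3 : K * (∫ t in a..b, ‖f t‖ ^ 2) ≤ K * (b - a) ^ 2 * D := by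
    rw [mul_assoc]
    gcongr
  have h4 : K * (b - a) ^ 2 * D ≤ c * D := by gcongr
  linarith

end AbsoluteContinuity

/-! ### Finiteness of the Morse index -/

section FiniteIndex

open scoped Topology

variable {n : ℕ} {M : Type*} [TopologicalSpace M] [ChartedSpace (EuclideanSpace ℝ (Fin n)) M]
  [IsManifold (𝓡 n) ∞ M]

theorem IsSobolevH1Field.locallyACAt {γ : ℝ → M} (hγ : ContMDiff 𝓘(ℝ, ℝ) (𝓡 n) ∞ γ)
    {V : ℝ → EuclideanSpace ℝ (Fin n)} (hV : IsSobolevH1Field γ V) {x₀ : M} {t : ℝ}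
    (h : γ t ∈ (extChartAt (𝓡 n) x₀).source) : LocallyACAt (chartField γ V x₀) t := by
  obtain ⟨δ, hδ, -, hS⟩ := hV t
  have hs := mem_extChartAt_source (I := 𝓡 n) (γ t)
  refine (LocallyACAt.of_sobolev hδ hS).clm_apply (contDiffAt_tangentCoordChange hγ hs h) ?_
  filter_upwards [eventually_mem_source hγ.continuous.continuousAt hs,
    eventually_mem_source hγ.continuous.continuousAt h] with s hs₀ hs₁
  exact chartField_coordChange V hs₀ hs₁

/-- One null set serves all charts, because differentiability of the components passes from one
chart to another. The densities need this, as they use the chart centred at the moving point `γ t`.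
-/
theorem IsSobolevH1Field.ae_differentiableAt {γ : ℝ → M} (hγ : ContMDiff 𝓘(ℝ, ℝ) (𝓡 n) ∞ γ)
    {V : ℝ → EuclideanSpace ℝ (Fin n)} (hV : IsSobolevH1Field γ V) :
    ∀ᵐ t, ∀ x₀ : M, γ t ∈ (extChartAt (𝓡 n) x₀).source →
      DifferentiableAt ℝ (chartField γ V x₀) t := by
  rw [ae_iff]
  refine measure_null_of_locally_null _ fun t _ ↦ ?_
  have hs := mem_extChartAt_source (I := 𝓡 n) (γ t)
  obtain ⟨U, hU, hUd⟩ := (hV.locallyACAt hγ hs).ae_differentiableAt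
  have hU' := Filter.inter_mem hU (eventually_mem_source hγ.continuous.continuousAt hs)
  refine ⟨_, Filter.inter_mem (mem_nhdsWithin_of_mem_nhds hU') self_mem_nhdsWithin, ?_⟩
  refine measure_mono_null ?_ (ae_iff.1 hUd)
  rintro r ⟨⟨hrU, hr⟩, hr'⟩ h'
  exact hr' fun x₀ hx₀ ↦ (hasDerivAt_chartField hγ hr hx₀ (h' hrU)).differentiableAt

theorem chartField_add (γ : ℝ → M) (V W : ℝ → EuclideanSpace ℝ (Fin n)) (x₀ : M) :
    chartField γ (V + W) x₀ = chartField γ V x₀ + chartField γ W x₀ :=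
  funext fun _ ↦ map_add _ _ _

theorem chartField_smul (γ : ℝ → M) (a : ℝ) (V : ℝ → EuclideanSpace ℝ (Fin n)) (x₀ : M) :
    chartField γ (a • V) x₀ = a • chartField γ V x₀ :=
  funext fun s ↦ (tangentCoordChange (𝓡 n) (γ s) x₀ (γ s)).map_smul a (V s)

theorem covDeriv_eq (g : LorentzMetric n M) (γ : ℝ → M) (V : ℝ → EuclideanSpace ℝ (Fin n))
    (t : ℝ) : covDeriv g γ V t = deriv (chartField γ V (γ t)) t +
      christoffelCLM (chartMetric g (γ t)) (extChartAt (𝓡 n) (γ t) (γ t)) (velocity γ t) (V t) :=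
  congrArg (deriv (chartField γ V (γ t)) t + ·) (christoffelCLM_apply _ _ _ _).symm

theorem covDeriv_add (g : LorentzMetric n M) {γ : ℝ → M} {V W : ℝ → EuclideanSpace ℝ (Fin n)}
    {t : ℝ} (hV : DifferentiableAt ℝ (chartField γ V (γ t)) t)
    (hW : DifferentiableAt ℝ (chartField γ W (γ t)) t) :
    covDeriv g γ (V + W) t =
      (covDeriv g γ V t : EuclideanSpace ℝ (Fin n)) + covDeriv g γ W t := by
  rw [covDeriv_eq, covDeriv_eq, covDeriv_eq, chartField_add, deriv_add hV hW, Pi.add_apply,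
    map_add]
  abel

theorem covDeriv_smul (g : LorentzMetric n M) {γ : ℝ → M} (a : ℝ)
    {V : ℝ → EuclideanSpace ℝ (Fin n)} {t : ℝ}
    (hV : DifferentiableAt ℝ (chartField γ V (γ t)) t) :
    covDeriv g γ (a • V) t = a • (covDeriv g γ V t : EuclideanSpace ℝ (Fin n)) := by
  rw [covDeriv_eq, covDeriv_eq, chartField_smul, deriv_const_smul a hV, Pi.smul_apply, map_smul]
  exact (smul_add a _ _).symm

theorem constraintDensity_add (g : LorentzMetric n M) (Y : (p : M) → TangentSpace (𝓡 n) p)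
    {γ : ℝ → M} {V W : ℝ → EuclideanSpace ℝ (Fin n)} {t : ℝ}
    (hV : DifferentiableAt ℝ (chartField γ V (γ t)) t)
    (hW : DifferentiableAt ℝ (chartField γ W (γ t)) t) :
    constraintDensity g Y γ (V + W) t =
      constraintDensity g Y γ V t + constraintDensity g Y γ W t := by
  have h : ∀ (b : EuclideanSpace ℝ (Fin n) →L[ℝ] EuclideanSpace ℝ (Fin n) →L[ℝ] ℝ)
      (x x₁ x₂ y v₁ v₂ z : EuclideanSpace ℝ (Fin n)), x = x₁ + x₂ →
      b x y - b (v₁ + v₂) z = (b x₁ y - b v₁ z) + (b x₂ y - b v₂ z) := by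
    rintro b x x₁ x₂ y v₁ v₂ z rfl
    simp only [map_add, add_apply]
    ring
  exact h _ _ _ _ _ _ _ _ (covDeriv_add g hV hW)

theorem constraintDensity_smul (g : LorentzMetric n M) (Y : (p : M) → TangentSpace (𝓡 n) p)
    {γ : ℝ → M} (a : ℝ) {V : ℝ → EuclideanSpace ℝ (Fin n)} {t : ℝ}
    (hV : DifferentiableAt ℝ (chartField γ V (γ t)) t) :
    constraintDensity g Y γ (a • V) t = a * constraintDensity g Y γ V t := by
  have h : ∀ (b : EuclideanSpace ℝ (Fin n) →L[ℝ] EuclideanSpace ℝ (Fin n) →L[ℝ] ℝ)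
      (x x₁ y v z : EuclideanSpace ℝ (Fin n)), x = a • x₁ →
      b x y - b (a • v) z = a * (b x₁ y - b v z) := by
    rintro b x x₁ y v z rfl
    simp only [map_smul, smul_apply, smul_eq_mul]
    ring
  exact h _ _ _ _ _ _ (covDeriv_smul g a hV)

/-- The constant in the constraint depends linearly on the field. -/
theorem exists_constraint_functional (g : LorentzMetric n M)
    (Y : (p : M) → TangentSpace (𝓡 n) p) {γ : ℝ → M} (hγ : ContMDiff 𝓘(ℝ, ℝ) (𝓡 n) ∞ γ)
    (W : Submodule ℝ ((t : ℝ) → TangentSpace (𝓡 n) (γ t)))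
    (hW : (W : Set ((t : ℝ) → TangentSpace (𝓡 n) (γ t))) ⊆ tangentConstraint g Y γ) :
    ∃ C : W →ₗ[ℝ] ℝ, ∀ w : W, ∀ᵐ t ∂(volume.restrict (Icc (0 : ℝ) 1)),
      constraintDensity g Y γ w.1 t = C w := by
  have h : ∀ w : W, ∃ C : ℝ, ∀ᵐ t ∂(volume.restrict (Icc (0 : ℝ) 1)),
      constraintDensity g Y γ w.1 t = C := fun w ↦ (hW w.2).2
  choose C hC using h
  have hd : ∀ w : W, ∀ᵐ t ∂(volume.restrict (Icc (0 : ℝ) 1)),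
      DifferentiableAt ℝ (chartField γ w.1 (γ t)) t := fun w ↦ by
    have h1 := IsSobolevH1Field.ae_differentiableAt hγ (hW w.2).1.1
    filter_upwards [ae_restrict_of_ae h1] with t ht using ht (γ t) (mem_extChartAt_source _)
  -- The interval has positive measure, so finitely many almost everywhere identities hold together
  -- at some point. Linearity of the constants is read off there.
  have hne : (volume.restrict (Icc (0 : ℝ) 1)) ≠ 0 := by
    rw [Ne, Measure.restrict_eq_zero]
    simp
  have : (ae (volume.restrict (Icc (0 : ℝ) 1))).NeBot := ae_neBot.2 hne
  refine ⟨⟨⟨C, fun v w ↦ ?_⟩, fun a v ↦ ?_⟩, hC⟩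
  · obtain ⟨t, h1, h2, h3, h4, h5⟩ :=
      ((hC (v + w)).and ((hC v).and ((hC w).and ((hd v).and (hd w))))).exists
    rw [← h1, ← h2, ← h3]
    exact constraintDensity_add g Y h4 h5
  · obtain ⟨t, h1, h2, h3⟩ := ((hC (a • v)).and ((hC v).and (hd v))).exists
    simp only [RingHom.id_apply, smul_eq_mul]
    rw [← h1, ← h2]
    exact constraintDensity_smul g Y a h3

/-- On short intervals the index form is nonnegative on the fields that vanish at the initial
point and satisfy the homogeneous constraint. -/
theorem exists_local_nonneg (g : LorentzMetric n M) {Y : (p : M) → TangentSpace (𝓡 n) p}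
    (hY : IsTimelikeKilling g Y) {γ : ℝ → M} (hγ : ContMDiff 𝓘(ℝ, ℝ) (𝓡 n) ∞ γ) (τ : ℝ) :
    ∃ δ > 0, ∀ a b, τ - δ < a → a ≤ b → b < τ + δ →
      ∀ V : ℝ → EuclideanSpace ℝ (Fin n), IsSobolevH1Field γ V → V a = 0 →
        (∀ᵐ t, t ∈ Icc a b → constraintDensity g Y γ V t = 0) →
        IntervalIntegrable (indexDensity g γ V) volume a b →
        0 ≤ ∫ t in a..b, indexDensity g γ V t := by
  obtain ⟨c, hc, K, hK⟩ := exists_local_lower_bound g hY hγ τ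
  obtain ⟨δ₀, hδ₀, hball⟩ := Metric.eventually_nhds_iff_ball.1 hK
  obtain ⟨δ₁, hδ₁, hsmall⟩ : ∃ δ₁ > 0, |K| * (2 * δ₁) ^ 2 ≤ c := by
    -- With `δ₁ ≤ 1` one has `|K| (2 δ₁)² ≤ 4 |K| δ₁ ≤ c`; here `2 δ₁` bounds the length of the
    -- interval.
    refine ⟨min 1 (c / (4 * (|K| + 1))), by positivity, ?_⟩
    set d := min 1 (c / (4 * (|K| + 1)))
    have hd0 : 0 ≤ d := by positivity
    have h1 : d ≤ 1 := min_le_left _ _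
    have h2 : d * (4 * (|K| + 1)) ≤ c := (le_div_iff₀ (by positivity)).1 (min_le_right _ _)
    nlinarith [abs_nonneg K, mul_nonneg (abs_nonneg K) hd0,
      mul_le_mul_of_nonneg_left h1 (mul_nonneg (abs_nonneg K) hd0)]
  refine ⟨min δ₀ δ₁, lt_min hδ₀ hδ₁, fun a b ha hab hb V hV hVa hcon hint ↦ ?_⟩
  have hm0 : min δ₀ δ₁ ≤ δ₀ := min_le_left _ _
  have hm1 : min δ₀ δ₁ ≤ δ₁ := min_le_right _ _
  have hmem : ∀ t ∈ Icc a b, t ∈ Metric.ball τ δ₀ := by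
    intro t ht
    rw [Metric.mem_ball, Real.dist_eq, abs_lt]
    constructor <;> linarith [ht.1, ht.2]
  refine integral_nonneg_of_lower_bound (f := chartField γ V (γ τ)) hab
    (fun t ht ↦ hV.locallyACAt hγ (hball t (hmem t ht)).1) ?_ hc (abs_nonneg K) ?_ hint ?_
  · have : chartField γ V (γ τ) a = tangentCoordChange (𝓡 n) (γ a) (γ τ) (γ a) (V a) := rfl
    rw [this, hVa, map_zero]
  · have : (b - a) ^ 2 ≤ (2 * δ₁) ^ 2 := by
      apply pow_le_pow_left₀ <;> linarith
    exact (mul_le_mul_of_nonneg_left this (abs_nonneg K)).trans hsmall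
  · filter_upwards [hcon, hV.ae_differentiableAt hγ] with t ht htd htab
    obtain ⟨hs, hb⟩ := hball t (hmem t htab)
    refine le_trans ?_ (hb V (htd _ hs) (ht htab))
    have := mul_le_mul_of_nonneg_right (le_abs_self K) (sq_nonneg ‖chartField γ V (γ τ) t‖)
    linarith

/-- The constraint constant and the values at the left endpoints of a fine partition are `1 + m n`
linear conditions. When they all vanish, each piece contributes a nonnegative amount to the index
form. -/
theorem morseIndex_ne_top (g : LorentzMetric n M) {Y : (p : M) → TangentSpace (𝓡 n) p}
    (hY : IsTimelikeKilling g Y) {γ : ℝ → M} (hγ : ContMDiff 𝓘(ℝ, ℝ) (𝓡 n) ∞ γ) :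
    morseIndex g Y γ ≠ ⊤ := by
  obtain ⟨t, m, h0, hm, hmono, hIcc, hP⟩ := exists_adapted_partition (zero_le_one (α := ℝ))
    (fun τ _ ↦ exists_local_nonneg g hY hγ τ)
  refine ne_top_of_le_ne_top (ENat.natCast_ne_top _)
    (negIndex_le_finrank (F := ℝ × (Fin m → EuclideanSpace ℝ (Fin n))) fun W hW ↦ ?_)
  obtain ⟨C, hC⟩ := exists_constraint_functional g Y hγ W hW
  let ev : W →ₗ[ℝ] (Fin m → EuclideanSpace ℝ (Fin n)) :=
    { toFun := fun w k ↦ w.1 (t k)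
      map_add' := fun _ _ ↦ rfl
      map_smul' := fun _ _ ↦ rfl }
  refine ⟨C.prod ev, fun w hw ↦ ?_⟩
  have hC0 : C w = 0 := congrArg Prod.fst hw
  have hev : ∀ k < m, (w.1 (t k) : EuclideanSpace ℝ (Fin n)) = 0 := fun k hk ↦
    congrFun (congrArg Prod.snd hw) ⟨k, hk⟩
  have hcon := (ae_restrict_iff' measurableSet_Icc).1 (hC w)
  change 0 ≤ ∫ t in (0 : ℝ)..1, indexDensity g γ w.1 t
  -- If the integrand is not integrable, the integral is `0` by default, which suffices. Otherwise
  -- it splits over the partition.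
  by_cases hint : IntervalIntegrable (indexDensity g γ w.1) volume 0 1
  swap
  · rw [intervalIntegral.integral_undef hint]
  have hsub : ∀ k, Icc (t k) (t (k + 1)) ⊆ Icc 0 1 := fun k ↦
    Icc_subset_Icc (hIcc k).1 (hIcc (k + 1)).2
  have hintk : ∀ k, IntervalIntegrable (indexDensity g γ w.1) volume (t k) (t (k + 1)) :=
    fun k ↦ hint.mono_set (by
      rw [uIcc_of_le (hmono (Nat.le_succ k)), uIcc_of_le zero_le_one]
      exact hsub k)
  have hsum := intervalIntegral.sum_integral_adjacent_intervals (n := m) fun k _ ↦ hintk k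
  rw [h0, hm] at hsum
  rw [← hsum]
  refine Finset.sum_nonneg fun k hk ↦ hP k w.1 (hW w.2).1.1 (hev k (Finset.mem_range.1 hk)) ?_
    (hintk k)
  filter_upwards [hcon] with s hs hsk
  rw [hs (hsub k hsk), hC0]

end FiniteIndex

/-! ### Restriction, gluing and rescaling of functions of class `H¹` -/

section Sobolev

variable {n : ℕ}

theorem IsSobolevH1On.mono {f : ℝ → EuclideanSpace ℝ (Fin n)} {a b a' b' : ℝ}
    (hf : IsSobolevH1On f a b) (ha : a ≤ a') (hab : a' ≤ b') (hb : b' ≤ b) :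
    IsSobolevH1On f a' b' := by
  obtain ⟨u, hu, hfu⟩ := hf
  have hle : a ≤ b := ha.trans (hab.trans hb)
  have hint := IsSobolevH1On.intervalIntegrable hle hu
  have hsub : ∀ s t, s ∈ Icc a b → t ∈ Icc a b → IntervalIntegrable u volume s t :=
    fun s t hs ht ↦ hint.mono_set (by
      rw [uIcc_of_le hle]
      exact (ordConnected_Icc.uIcc_subset hs ht))
  have ha' : a' ∈ Icc a b := ⟨ha, hab.trans hb⟩
  refine ⟨u, hu.mono_measure (Measure.restrict_mono (Icc_subset_Icc ha hb) le_rfl),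
    fun t ht ↦ ?_⟩
  have ht' : t ∈ Icc a b := ⟨ha.trans ht.1, ht.2.trans hb⟩
  have haa : a ∈ Icc a b := left_mem_Icc.2 hle
  rw [hfu t ht', hfu a' ha', add_assoc,
    intervalIntegral.integral_add_adjacent_intervals (hsub a a' haa ha') (hsub a' t ha' ht')]

theorem IsSobolevH1On.zero_on {f : ℝ → EuclideanSpace ℝ (Fin n)} {a b : ℝ} (hab : a ≤ b)
    (hf : ∀ t ∈ Icc a b, f t = 0) : IsSobolevH1On f a b := by
  refine ⟨0, MemLp.zero, fun t ht ↦ ?_⟩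
  rw [hf t ht, hf a (left_mem_Icc.2 hab)]
  simp

theorem IsSobolevH1On.union {f : ℝ → EuclideanSpace ℝ (Fin n)} {a b c : ℝ} (hab : a ≤ b)
    (hbc : b ≤ c) (h₁ : IsSobolevH1On f a b) (h₂ : IsSobolevH1On f b c) :
    IsSobolevH1On f a c := by
  obtain ⟨u, hu, hfu⟩ := h₁
  obtain ⟨v, hv, hfv⟩ := h₂
  set w : ℝ → EuclideanSpace ℝ (Fin n) := (Iic b).piecewise u v with hw
  have hwu : ∀ t ∈ Icc a b, w t = u t := fun t ht ↦ piecewise_eq_of_mem _ _ _ ht.2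
  have hwv : ∀ t ∈ Ioc b c, w t = v t := fun t ht ↦
    piecewise_eq_of_notMem _ _ _ (not_le.2 ht.1)
  have iu := IsSobolevH1On.intervalIntegrable hab hu
  have iv := IsSobolevH1On.intervalIntegrable hbc hv
  have eu : ∀ t ∈ Icc a b, ∫ s in a..t, w s = ∫ s in a..t, u s := fun t ht ↦
    intervalIntegral.integral_congr fun s hs ↦ by
      rw [uIcc_of_le ht.1] at hs
      exact hwu s ⟨hs.1, hs.2.trans ht.2⟩
  have ev : ∀ t ∈ Icc b c, ∫ s in b..t, w s = ∫ s in b..t, v s := fun t ht ↦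
    intervalIntegral.integral_congr_ae (Filter.Eventually.of_forall fun s hs ↦ by
      rw [uIoc_of_le ht.1] at hs
      exact hwv s ⟨hs.1, hs.2.trans ht.2⟩)
  have mw : MemLp w 2 (volume.restrict (Icc a c)) := by
    refine MemLp.piecewise measurableSet_Iic (hu.mono_measure ?_) (hv.mono_measure ?_)
    · rw [Measure.restrict_restrict measurableSet_Iic]
      exact Measure.restrict_mono (show Iic b ∩ Icc a c ⊆ Icc a b from fun t ht ↦ ⟨ht.2.1, ht.1⟩) le_rfl
    · rw [Measure.restrict_restrict measurableSet_Iic.compl]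
      exact Measure.restrict_mono (show (Iic b)ᶜ ∩ Icc a c ⊆ Icc b c from
        fun t ht ↦ ⟨(lt_of_not_ge fun h ↦ ht.1 h).le, ht.2.2⟩) le_rfl
  refine ⟨w, mw, fun t ht ↦ ?_⟩
  have iw := IsSobolevH1On.intervalIntegrable (hab.trans hbc) mw
  rcases le_total t b with htb | htb
  · rw [eu t ⟨ht.1, htb⟩]
    exact hfu t ⟨ht.1, htb⟩
  · have hsub : ∀ s r, s ∈ Icc a c → r ∈ Icc a c → IntervalIntegrable w volume s r :=
      fun s r hs hr ↦ iw.mono_set (by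
        rw [uIcc_of_le (hab.trans hbc)]
        exact (ordConnected_Icc.uIcc_subset hs hr))
    rw [← intervalIntegral.integral_add_adjacent_intervals
      (hsub a b (left_mem_Icc.2 (hab.trans hbc)) ⟨hab, hbc⟩) (hsub b t ⟨hab, hbc⟩ ht),
      eu b ⟨hab, le_rfl⟩, ev t ⟨htb, ht.2⟩, ← add_assoc, ← hfu b ⟨hab, le_rfl⟩]
    exact hfv t ⟨htb, ht.2⟩

theorem IntervalIntegrable.comp_affine {F : Type*} [NormedAddCommGroup F] {f : ℝ → F}
    {a b c d : ℝ} (hc : c ≠ 0) (hf : IntervalIntegrable f volume (c * a + d) (c * b + d)) :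
    IntervalIntegrable (fun t ↦ f (c * t + d)) volume a b := by
  have h1 := (hf.comp_add_right d).comp_mul_left (c := c)
  simp only [add_sub_cancel_right] at h1
  rwa [mul_div_cancel_left₀ _ hc, mul_div_cancel_left₀ _ hc] at h1

theorem IsSobolevH1On.comp_affine {f f' : ℝ → EuclideanSpace ℝ (Fin n)} {a b c d : ℝ}
    (hc : 0 < c) (hab : a ≤ b) (hf : IsSobolevH1On f (c * a + d) (c * b + d))
    (h : ∀ t ∈ Icc a b, f' t = f (c * t + d)) : IsSobolevH1On f' a b := by
  obtain ⟨u, hu, hfu⟩ := hf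
  have hle : ∀ s t : ℝ, s ≤ t → c * s + d ≤ c * t + d := fun s t hst ↦ by gcongr
  have i1 := (IsSobolevH1On.intervalIntegrable (hle a b hab) hu).comp_affine hc.ne'
  have i2 : IntervalIntegrable (fun s ↦ ‖u s‖ ^ 2) volume (c * a + d) (c * b + d) := by
    rw [intervalIntegrable_iff_integrableOn_Icc_of_le (hle a b hab)]
    exact (memLp_two_iff_integrable_sq_norm hu.1).1 hu
  have i3 := i2.comp_affine hc.ne'
  rw [intervalIntegrable_iff_integrableOn_Icc_of_le hab] at i1 i3
  refine ⟨fun t ↦ c • u (c * t + d),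
    ((memLp_two_iff_integrable_sq_norm i1.aestronglyMeasurable).2 i3).const_smul c,
    fun t ht ↦ ?_⟩
  rw [h t ht, h a (left_mem_Icc.2 hab), hfu _ ⟨hle _ _ ht.1, hle _ _ ht.2⟩,
    intervalIntegral.integral_smul, intervalIntegral.smul_integral_comp_mul_add]

end Sobolev

/-! ### Behaviour of the densities under an affine change of time -/

section Reparametrization

open scoped Topology

variable {n : ℕ} {M : Type*} [TopologicalSpace M] [ChartedSpace (EuclideanSpace ℝ (Fin n)) M]

theorem deriv_comp_affine {F : Type*} [NormedAddCommGroup F] [NormedSpace ℝ F] (f : ℝ → F)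
    (c d t : ℝ) : deriv (fun s ↦ f (c * s + d)) t = c • deriv f (c * t + d) := by
  have h1 := deriv_comp_mul_left c (fun s ↦ f (s + d)) t
  rw [h1, deriv_comp_add_const]

theorem velocity_comp_affine {σ σ' : ℝ → M} (hσ : ContMDiff 𝓘(ℝ, ℝ) (𝓡 n) ∞ σ)
    (hσ' : ContMDiff 𝓘(ℝ, ℝ) (𝓡 n) ∞ σ') {c d : ℝ} (h : ∀ t, σ' t = σ (c * t + d)) (t : ℝ) :
    (velocity σ' t : EuclideanSpace ℝ (Fin n)) = c • velocity σ (c * t + d) := by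
  have h1 : chartCurve n σ' (σ' t) = fun s ↦ chartCurve n σ (σ (c * t + d)) (c * s + d) := by
    ext1 s
    simp only [chartCurve, h s, h t]
  have h2 : deriv (chartCurve n σ' (σ' t)) t =
      c • deriv (chartCurve n σ (σ (c * t + d))) (c * t + d) := by
    rw [h1, deriv_comp_affine]
  rw [velocity_eq_deriv hσ', velocity_eq_deriv hσ]
  exact h2

variable [IsManifold (𝓡 n) ∞ M]

theorem chartField_comp {σ σ' : ℝ → M} {V V' : ℝ → EuclideanSpace ℝ (Fin n)} {s t : ℝ}
    (hσ : σ' t = σ s) (hV : V' t = V s) (x₀ : M) :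
    chartField σ' V' x₀ t = chartField σ V x₀ s := by
  have h1 : chartField σ' V' x₀ t = tangentCoordChange (𝓡 n) (σ' t) x₀ (σ' t) (V' t) := rfl
  rw [h1, hσ, hV]
  rfl

/-- The chain rule. Agreement of the fields near `t` is enough, which matters because an extension
by zero is a rescaled field only on part of each period. -/
theorem covDeriv_comp_affine (g : LorentzMetric n M) {σ σ' : ℝ → M}
    (hσ : ContMDiff 𝓘(ℝ, ℝ) (𝓡 n) ∞ σ) (hσ' : ContMDiff 𝓘(ℝ, ℝ) (𝓡 n) ∞ σ') {c d : ℝ}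
    (h : ∀ t, σ' t = σ (c * t + d)) {V V' : ℝ → EuclideanSpace ℝ (Fin n)} {t : ℝ}
    (hV : ∀ᶠ s in 𝓝 t, V' s = V (c * s + d)) :
    (covDeriv g σ' V' t : EuclideanSpace ℝ (Fin n)) = c • covDeriv g σ V (c * t + d) := by
  have h1 : chartField σ' V' (σ' t) =ᶠ[𝓝 t] fun s ↦ chartField σ V (σ' t) (c * s + d) := by
    filter_upwards [hV] with s hs using chartField_comp (h s) hs _
  have h2 : deriv (chartField σ' V' (σ' t)) t =
      c • deriv (chartField σ V (σ (c * t + d))) (c * t + d) := by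
    rw [h1.deriv_eq, deriv_comp_affine (chartField σ V (σ' t)), h t]
  have h3 := velocity_comp_affine hσ hσ' h t
  -- All tangent spaces are the same coordinate space, so the equality of the two base points may be
  -- substituted once everything depending on them is generalized.
  have h4 : ∀ (p q : M) (x x' u u' v v' : EuclideanSpace ℝ (Fin n)), p = q → x = c • x' →
      u = c • u' → v = v' →
      x + christoffelCLM (chartMetric g p) (extChartAt (𝓡 n) p p) u v =
        c • (x' + christoffelCLM (chartMetric g q) (extChartAt (𝓡 n) q q) u' v') := by
    rintro p q x x' u u' v v' rfl rfl rfl rfl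
    simp only [map_smul, smul_apply, smul_add]
  rw [covDeriv_eq, covDeriv_eq]
  exact h4 _ _ _ _ _ _ _ _ (h t) h2 h3 hV.self_of_nhds

theorem covDeriv_of_eventually_zero (g : LorentzMetric n M) {σ : ℝ → M}
    {V : ℝ → EuclideanSpace ℝ (Fin n)} {t : ℝ} (hV : ∀ᶠ s in 𝓝 t, V s = 0) :
    covDeriv g σ V t = (0 : EuclideanSpace ℝ (Fin n)) := by
  have h1 : chartField σ V (σ t) =ᶠ[𝓝 t] fun _ ↦ 0 := by
    filter_upwards [hV] with s hs
    have : chartField σ V (σ t) s = tangentCoordChange (𝓡 n) (σ s) (σ t) (σ s) (V s) := rfl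
    rw [this, hs, map_zero]
  rw [covDeriv_eq, h1.deriv_eq, hV.self_of_nhds, map_zero, deriv_const, add_zero]

/-- The integrand of the index form as a function of the covariant derivative `a`, the velocity
`u` and the value `v`. -/
def pointDensity (g : LorentzMetric n M) (p : M) (a u v : EuclideanSpace ℝ (Fin n)) : ℝ :=
  metricAt g p a a + metricAt g p (curvature g p u v u) v

theorem flatCurvature_smul {E : Type*} [NormedAddCommGroup E] [NormedSpace ℝ E] [CompleteSpace E]
    {G : E → E →L[ℝ] E →L[ℝ] ℝ} {y : E}
    (hG : ContDiffAt ℝ ∞ G y) (hi : (G y).IsInvertible) (c : ℝ) (u v : E) :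
    flatCurvature G y (c • u) v (c • u) = c ^ 2 • flatCurvature G y u v u := by
  rw [flatCurvature, flatCurvature, IsMetricPullback.fderiv_flatChristoffel hG hi,
    IsMetricPullback.fderiv_flatChristoffel hG hi, IsMetricPullback.fderiv_flatChristoffel hG hi,
    IsMetricPullback.fderiv_flatChristoffel hG hi]
  simp only [← christoffelCLM_apply, map_smul, smul_apply, smul_sub, smul_add, smul_smul, sq]

theorem curvature_smul (g : LorentzMetric n M) (p : M) (c : ℝ)
    (u v : EuclideanSpace ℝ (Fin n)) :
    curvature g p (c • u) v (c • u) = c ^ 2 • (curvature g p u v u : EuclideanSpace ℝ (Fin n)) := by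
  have hp : extChartAt (𝓡 n) p p ∈ (extChartAt (𝓡 n) p).target := mem_extChartAt_target p
  exact flatCurvature_smul ((g.smooth p).contDiffAt
    ((isOpen_extChartAt_target (I := 𝓡 n) p).mem_nhds hp)) (chartMetric_isInvertible g p hp) c u v

/-- A change of time by the factor `c` multiplies both the covariant derivative and the velocity by
`c`. The curvature term is quadratic in the velocity, so both terms scale by `c ^ 2`. -/
theorem pointDensity_smul (g : LorentzMetric n M) (p : M) (c : ℝ)
    (a u v : EuclideanSpace ℝ (Fin n)) :
    pointDensity g p (c • a) (c • u) v = c ^ 2 * pointDensity g p a u v := by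
  have h : ∀ (b : EuclideanSpace ℝ (Fin n) →L[ℝ] EuclideanSpace ℝ (Fin n) →L[ℝ] ℝ)
      (x y : EuclideanSpace ℝ (Fin n)), x = c ^ 2 • y →
      b (c • a) (c • a) + b x v = c ^ 2 * (b a a + b y v) := by
    rintro b x y rfl
    simp only [map_smul, smul_apply, smul_eq_mul]
    ring
  exact h _ _ _ (curvature_smul g p c u v)

theorem indexDensity_comp_affine (g : LorentzMetric n M) {σ σ' : ℝ → M}
    (hσ : ContMDiff 𝓘(ℝ, ℝ) (𝓡 n) ∞ σ) (hσ' : ContMDiff 𝓘(ℝ, ℝ) (𝓡 n) ∞ σ') {c d : ℝ}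
    (h : ∀ t, σ' t = σ (c * t + d)) {V V' : ℝ → EuclideanSpace ℝ (Fin n)} {t : ℝ}
    (hV : ∀ᶠ s in 𝓝 t, V' s = V (c * s + d)) :
    indexDensity g σ' V' t = c ^ 2 * indexDensity g σ V (c * t + d) := by
  have e : ∀ (p q : M) (a a' u u' v v' : EuclideanSpace ℝ (Fin n)), p = q → a = c • a' →
      u = c • u' → v = v' → pointDensity g p a u v = c ^ 2 * pointDensity g q a' u' v' := by
    rintro p q a a' u u' v v' rfl rfl rfl rfl
    exact pointDensity_smul g p c a' u' v
  exact e _ _ _ _ _ _ _ _ (h t) (covDeriv_comp_affine g hσ hσ' h hV)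
    (velocity_comp_affine hσ hσ' h t) hV.self_of_nhds

theorem indexDensity_of_eventually_zero (g : LorentzMetric n M) {σ : ℝ → M}
    {V : ℝ → EuclideanSpace ℝ (Fin n)} {t : ℝ} (hV : ∀ᶠ s in 𝓝 t, V s = 0) :
    indexDensity g σ V t = 0 := by
  have e : ∀ (b : EuclideanSpace ℝ (Fin n) →L[ℝ] EuclideanSpace ℝ (Fin n) →L[ℝ] ℝ)
      (x y z : EuclideanSpace ℝ (Fin n)), x = 0 → z = 0 → b x x + b y z = 0 := by
    rintro b x y z rfl rfl
    simp
  exact e _ _ _ _ (covDeriv_of_eventually_zero g hV) hV.self_of_nhds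

theorem constraintDensity_comp_affine (g : LorentzMetric n M)
    (Y : (p : M) → TangentSpace (𝓡 n) p) {σ σ' : ℝ → M}
    (hσ : ContMDiff 𝓘(ℝ, ℝ) (𝓡 n) ∞ σ) (hσ' : ContMDiff 𝓘(ℝ, ℝ) (𝓡 n) ∞ σ') {c d : ℝ}
    (h : ∀ t, σ' t = σ (c * t + d)) {V V' : ℝ → EuclideanSpace ℝ (Fin n)} {t : ℝ}
    (hV : ∀ᶠ s in 𝓝 t, V' s = V (c * s + d)) :
    constraintDensity g Y σ' V' t = c * constraintDensity g Y σ V (c * t + d) := by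
  let Y' : M → EuclideanSpace ℝ (Fin n) := Y
  have e1 := covDeriv_comp_affine g hσ hσ' h hV
  have e2 := covDeriv_comp_affine g hσ hσ' h (V := fun s ↦ Y' (σ s)) (V' := fun s ↦ Y' (σ' s))
    (t := t) (Filter.Eventually.of_forall fun s ↦ by rw [h s])
  have e3 : ∀ (p q : M) (x x' v v' w w' : EuclideanSpace ℝ (Fin n)), p = q → x = c • x' →
      v = v' → w = c • w' →
      metricAt g p x (Y' p) - metricAt g p v w =
        c * (metricAt g q x' (Y' q) - metricAt g q v' w') := by
    rintro p q x x' v v' w w' rfl rfl rfl rfl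
    simp only [map_smul, smul_apply, smul_eq_mul]
    ring
  exact e3 _ _ _ _ _ _ _ _ (h t) e1 hV.self_of_nhds e2

theorem constraintDensity_of_eventually_zero (g : LorentzMetric n M)
    (Y : (p : M) → TangentSpace (𝓡 n) p) {σ : ℝ → M}
    {V : ℝ → EuclideanSpace ℝ (Fin n)} {t : ℝ} (hV : ∀ᶠ s in 𝓝 t, V s = 0) :
    constraintDensity g Y σ V t = 0 := by
  have e : ∀ (b : EuclideanSpace ℝ (Fin n) →L[ℝ] EuclideanSpace ℝ (Fin n) →L[ℝ] ℝ)
      (x v y z : EuclideanSpace ℝ (Fin n)), x = 0 → v = 0 → b x y - b v z = 0 := by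
    rintro b x v y z rfl rfl
    simp
  exact e _ _ _ _ _ (covDeriv_of_eventually_zero g hV) hV.self_of_nhds

/-- The radius `η` serves every subinterval, in particular those on one side of `t₀`. At a junction
the extended field is a rescaling of `V` on one side only. -/
theorem exists_sobolev_comp_affine {σ σ' : ℝ → M} {c d : ℝ} (hc : 0 < c)
    (h : ∀ t, σ' t = σ (c * t + d)) {V V' : ℝ → EuclideanSpace ℝ (Fin n)}
    (hV : IsSobolevH1Field σ V) (t₀ : ℝ) :
    ∃ η > 0, ∀ a b, t₀ - η ≤ a → a ≤ b → b ≤ t₀ + η → (∀ t ∈ Icc a b, V' t = V (c * t + d)) →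
      IsSobolevH1On (chartField σ' V' (σ' t₀)) a b := by
  obtain ⟨δ, hδ, -, hS⟩ := hV (c * t₀ + d)
  have hη : c * (δ / c) = δ := by field_simp
  refine ⟨δ / c, div_pos hδ hc, fun a b ha hab hb hVV ↦ ?_⟩
  rw [h t₀]
  refine IsSobolevH1On.comp_affine hc hab (hS.mono ?_ (by gcongr) ?_) fun t ht ↦
    chartField_comp (h t) (hVV t ht) _
  · have := mul_le_mul_of_nonneg_left ha hc.le
    rw [mul_sub, hη] at this
    linarith
  · have := mul_le_mul_of_nonneg_left hb hc.le
    rw [mul_add, hη] at this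
    linarith

theorem isSobolevH1On_chartField_zero {σ : ℝ → M} {V : ℝ → EuclideanSpace ℝ (Fin n)} {a b : ℝ}
    (hab : a ≤ b) (hV : ∀ t ∈ Icc a b, V t = 0) (x₀ : M) :
    IsSobolevH1On (chartField σ V x₀) a b := by
  refine IsSobolevH1On.zero_on hab fun t ht ↦ ?_
  have : chartField σ V x₀ t = tangentCoordChange (𝓡 n) (σ t) x₀ (σ t) (V t) := rfl
  rw [this, hV t ht, map_zero]

end Reparametrization

/-! ### Extension by zero and the comparison of the indices of two iterates -/

section ExtensionByZero

open scoped Topology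

variable {n : ℕ}

/-- The 1-periodic field that runs through `V` on `[0, 1 / c]` and vanishes on `[1 / c, 1]`. -/
def extendByZero (c : ℝ) :
    (ℝ → EuclideanSpace ℝ (Fin n)) →ₗ[ℝ] (ℝ → EuclideanSpace ℝ (Fin n)) where
  toFun V t := if c * Int.fract t ≤ 1 then V (c * Int.fract t) else 0
  map_add' V W := by
    ext1 t
    simp only [Pi.add_apply]
    split_ifs <;> simp
  map_smul' a V := by
    ext1 t
    simp only [Pi.smul_apply, RingHom.id_apply]
    split_ifs <;> simp

theorem extendByZero_apply (c : ℝ) (V : ℝ → EuclideanSpace ℝ (Fin n)) (t : ℝ) :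
    extendByZero c V t = if c * Int.fract t ≤ 1 then V (c * Int.fract t) else 0 := rfl

theorem extendByZero_periodic (c : ℝ) (V : ℝ → EuclideanSpace ℝ (Fin n)) (t : ℝ) :
    extendByZero c V (t + 1) = extendByZero c V t := by
  rw [extendByZero_apply, extendByZero_apply, Int.fract_add_one]

theorem fract_eq_of_mem {k : ℤ} {t : ℝ} (h₀ : (k : ℝ) ≤ t) (h₁ : t < k + 1) :
    Int.fract t = t - k :=
  Int.fract_eq_iff.2 ⟨by linarith, by linarith, k, by ring⟩

theorem extendByZero_of_le {c : ℝ} (hc : 1 < c) (V : ℝ → EuclideanSpace ℝ (Fin n)) {k : ℤ} {t : ℝ}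
    (h₀ : (k : ℝ) ≤ t) (h₁ : t ≤ k + 1 / c) : extendByZero c V t = V (c * t + -(c * k)) := by
  have hc0 : 0 < c := by linarith
  have h2 : 1 / c < 1 := (div_lt_one hc0).2 hc
  have h3 : c * (t - k) ≤ 1 := by
    have := mul_le_mul_of_nonneg_left (show t - k ≤ 1 / c by linarith) hc0.le
    rwa [mul_one_div_cancel hc0.ne'] at this
  rw [extendByZero_apply, fract_eq_of_mem h₀ (by linarith), if_pos h3]
  congr 1
  ring

theorem extendByZero_eq_zero {c : ℝ} (hc : 1 < c) {V : ℝ → EuclideanSpace ℝ (Fin n)}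
    (hV0 : V 0 = 0) (hV1 : V 1 = 0) {k : ℤ} {t : ℝ}
    (h₀ : k + 1 / c ≤ t) (h₁ : t ≤ k + 1) : extendByZero c V t = 0 := by
  have hc0 : 0 < c := by linarith
  have h2 : 0 < 1 / c := one_div_pos.2 hc0
  rw [extendByZero_apply]
  rcases h₁.eq_or_lt with rfl | h₁
  -- At the right end of the period the fractional part is `0`, so the value is `V 0`. At the left
  -- end `k + 1 / c`, treated in the other case, it is `V 1`.
  · have : Int.fract ((k : ℝ) + 1) = 0 := by
      rw [Int.fract_add_one, Int.fract_intCast]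
    rw [this, mul_zero, hV0, ite_self]
  · rw [fract_eq_of_mem (by linarith) h₁]
    have h3 : 1 ≤ c * (t - k) := by
      have := mul_le_mul_of_nonneg_left (show 1 / c ≤ t - k by linarith) hc0.le
      rwa [mul_one_div_cancel hc0.ne'] at this
    split_ifs with h4
    · rw [le_antisymm h4 h3, hV1]
    · rfl

variable {M : Type*} [TopologicalSpace M] [ChartedSpace (EuclideanSpace ℝ (Fin n)) M]

theorem contMDiff_iterateCurve {γ : ℝ → M} (hγ : ContMDiff 𝓘(ℝ, ℝ) (𝓡 n) ∞ γ) (N : ℕ) :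
    ContMDiff 𝓘(ℝ, ℝ) (𝓡 n) ∞ (iterateCurve γ N) :=
  hγ.comp (contMDiff_iff_contDiff.2 (contDiff_const.mul contDiff_id))

variable [IsManifold (𝓡 n) ∞ M]

/-- On each side of `t₀` the field is either a rescaling of `V` or zero, hence of class `H¹`. Gluing
requires only that the values match, and they do because `V` vanishes at `0` and `1`. -/
theorem isSobolevH1Field_extendByZero {σ σ' : ℝ → M} (hσ' : Continuous σ') {c : ℝ} (hc : 1 < c)
    (h : ∀ (k : ℤ) t, σ' t = σ (c * t + -(c * k))) {V : ℝ → EuclideanSpace ℝ (Fin n)}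
    (hV : IsSobolevH1Field σ V) (hV0 : V 0 = 0) (hV1 : V 1 = 0) :
    IsSobolevH1Field σ' (extendByZero c V) := by
  have hc0 : 0 < c := by linarith
  have hc1 : 0 < 1 / c := one_div_pos.2 hc0
  have hc2 : 1 / c < 1 := (div_lt_one hc0).2 hc
  intro t₀
  obtain ⟨k, hk0, hk1⟩ : ∃ k : ℤ, (k : ℝ) ≤ t₀ ∧ t₀ < k + 1 :=
    ⟨⌊t₀⌋, Int.floor_le t₀, Int.lt_floor_add_one t₀⟩
  obtain ⟨η, hη, hS⟩ := exists_sobolev_comp_affine hc0 (h k) (V' := extendByZero c V) hV t₀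
  have hright : ∃ δ > 0,
      IsSobolevH1On (chartField σ' (extendByZero c V) (σ' t₀)) t₀ (t₀ + δ) := by
    by_cases hlt : t₀ < k + 1 / c
    · refine ⟨min η (k + 1 / c - t₀), lt_min hη (by linarith), ?_⟩
      have h1 := min_le_left η (k + 1 / c - t₀)
      have h2 := min_le_right η (k + 1 / c - t₀)
      have h3 : 0 < min η (k + 1 / c - t₀) := lt_min hη (by linarith)
      exact hS _ _ (by linarith) (by linarith) (by linarith) fun t ht ↦
        extendByZero_of_le hc V (hk0.trans ht.1) (by linarith [ht.2])
    · refine ⟨k + 1 - t₀, by linarith, isSobolevH1On_chartField_zero (by linarith) ?_ _⟩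
      intro t ht
      exact extendByZero_eq_zero hc hV0 hV1 (k := k) (by linarith [ht.1]) (by linarith [ht.2])
  have hleft : ∃ δ > 0,
      IsSobolevH1On (chartField σ' (extendByZero c V) (σ' t₀)) (t₀ - δ) t₀ := by
    rcases hk0.eq_or_lt with rfl | hk0
    -- To the left of `t₀ = k` lies the part of the preceding period where the field is zero.
    · refine ⟨1 - 1 / c, by linarith, isSobolevH1On_chartField_zero (by linarith) ?_ _⟩
      intro t ht
      refine extendByZero_eq_zero hc hV0 hV1 (k := k - 1) ?_ ?_ <;> push_cast <;>
        linarith [ht.1, ht.2]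
    · by_cases hle : t₀ ≤ k + 1 / c
      · refine ⟨min η (t₀ - k), lt_min hη (by linarith), ?_⟩
        have h1 := min_le_left η (t₀ - k)
        have h2 := min_le_right η (t₀ - k)
        have h3 : 0 < min η (t₀ - k) := lt_min hη (by linarith)
        exact hS _ _ (by linarith) (by linarith) (by linarith) fun t ht ↦
          extendByZero_of_le hc V (by linarith [ht.1]) (ht.2.trans hle)
      · refine ⟨t₀ - (k + 1 / c), by linarith,
          isSobolevH1On_chartField_zero (by linarith) ?_ _⟩
        intro t ht
        exact extendByZero_eq_zero hc hV0 hV1 (k := k) (by linarith [ht.1]) (by linarith [ht.2])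
  obtain ⟨δ₁, hδ₁, h₁⟩ := hright
  obtain ⟨δ₂, hδ₂, h₂⟩ := hleft
  obtain ⟨δ₃, hδ₃, h₃⟩ := Metric.eventually_nhds_iff_ball.1
    (eventually_mem_source hσ'.continuousAt (mem_extChartAt_source (I := 𝓡 n) (σ' t₀)))
  have m1 : min (min δ₁ δ₂) (δ₃ / 2) ≤ δ₁ := (min_le_left _ _).trans (min_le_left _ _)
  have m2 : min (min δ₁ δ₂) (δ₃ / 2) ≤ δ₂ := (min_le_left _ _).trans (min_le_right _ _)
  have m3 : min (min δ₁ δ₂) (δ₃ / 2) ≤ δ₃ / 2 := min_le_right _ _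
  have m0 : 0 < min (min δ₁ δ₂) (δ₃ / 2) := lt_min (lt_min hδ₁ hδ₂) (half_pos hδ₃)
  refine ⟨min (min δ₁ δ₂) (δ₃ / 2), m0, fun t ht ↦ ?_, ?_⟩
  · rw [← extChartAt_source (𝓡 n)]
    refine h₃ t ?_
    rw [Metric.mem_ball, Real.dist_eq, abs_lt]
    constructor <;> linarith [ht.1, ht.2]
  · exact (h₂.mono (by linarith) (by linarith) le_rfl).union (by linarith) (by linarith)
      (h₁.mono le_rfl (by linarith) (by linarith))

theorem extendByZero_eventuallyEq {c : ℝ} (hc : 1 < c) (V : ℝ → EuclideanSpace ℝ (Fin n)) {t : ℝ}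
    (h₀ : 0 < t) (h₁ : t < 1 / c) :
    ∀ᶠ s in 𝓝 t, extendByZero c V s = V (c * s + -(c * (0 : ℤ))) := by
  filter_upwards [Ioo_mem_nhds h₀ h₁] with s hs
  exact extendByZero_of_le hc V (by simpa using hs.1.le) (by simpa using hs.2.le)

theorem extendByZero_eventually_zero {c : ℝ} (hc : 1 < c) {V : ℝ → EuclideanSpace ℝ (Fin n)}
    (hV0 : V 0 = 0) (hV1 : V 1 = 0) {t : ℝ} (h₀ : 1 / c < t) (h₁ : t < 1) :
    ∀ᶠ s in 𝓝 t, extendByZero c V s = 0 := by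
  filter_upwards [Ioo_mem_nhds h₀ h₁] with s hs
  exact extendByZero_eq_zero hc hV0 hV1 (k := 0) (by simpa using hs.1.le) (by simpa using hs.2.le)

theorem ae_comp_mul {p : ℝ → Prop} {c : ℝ} (hc : c ≠ 0) (hp : ∀ᵐ t, p t) : ∀ᵐ t, p (c * t) := by
  rw [ae_iff] at hp ⊢
  have h := Real.volume_preimage_mul_left hc {t | ¬ p t}
  rw [hp, mul_zero] at h
  exact h

/-- The density of the extension vanishes on `(1 / c, 1)`, so a nonzero constant on `(0, 1 / c)`
would violate the constraint. This is why the comparison is restricted to fields with constant `0`.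
-/
theorem constraintDensity_extendByZero (g : LorentzMetric n M)
    (Y : (p : M) → TangentSpace (𝓡 n) p) {σ σ' : ℝ → M}
    (hσ : ContMDiff 𝓘(ℝ, ℝ) (𝓡 n) ∞ σ) (hσ' : ContMDiff 𝓘(ℝ, ℝ) (𝓡 n) ∞ σ') {c : ℝ} (hc : 1 < c)
    (h : ∀ (k : ℤ) t, σ' t = σ (c * t + -(c * k))) {V : ℝ → EuclideanSpace ℝ (Fin n)}
    (hV0 : V 0 = 0) (hV1 : V 1 = 0)
    (hcon : ∀ᵐ t ∂(volume.restrict (Icc (0 : ℝ) 1)), constraintDensity g Y σ V t = 0) :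
    ∀ᵐ t ∂(volume.restrict (Icc (0 : ℝ) 1)),
      constraintDensity g Y σ' (extendByZero c V) t = 0 := by
  have hc0 : 0 < c := by linarith
  rw [ae_restrict_iff' measurableSet_Icc] at hcon ⊢
  filter_upwards [ae_comp_mul hc0.ne' hcon, Measure.ae_ne volume (0 : ℝ),
    Measure.ae_ne volume (1 : ℝ), Measure.ae_ne volume (1 / c)] with t ht h0 h1 hne ht01
  have ht0 : 0 < t := lt_of_le_of_ne ht01.1 h0.symm
  rcases lt_or_gt_of_ne hne with hlt | hgt
  · rw [constraintDensity_comp_affine g Y hσ hσ' (h 0) (extendByZero_eventuallyEq hc V ht0 hlt)]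
    have e : c * t + -(c * (0 : ℤ)) = c * t := by simp
    rw [e, ht ⟨by positivity, ?_⟩, mul_zero]
    have := mul_lt_mul_of_pos_left hlt hc0
    rw [mul_one_div_cancel hc0.ne'] at this
    exact this.le
  · exact constraintDensity_of_eventually_zero g Y
      (extendByZero_eventually_zero hc hV0 hV1 hgt (lt_of_le_of_ne ht01.2 h1))

/-- The integrand contributes `c ^ 2` and the substitution `s = c t` contributes `1 / c`. The
resulting factor is positive, so negative vectors stay negative. -/
theorem integral_indexDensity_extendByZero (g : LorentzMetric n M) {σ σ' : ℝ → M}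
    (hσ : ContMDiff 𝓘(ℝ, ℝ) (𝓡 n) ∞ σ) (hσ' : ContMDiff 𝓘(ℝ, ℝ) (𝓡 n) ∞ σ') {c : ℝ} (hc : 1 < c)
    (h : ∀ (k : ℤ) t, σ' t = σ (c * t + -(c * k))) {V : ℝ → EuclideanSpace ℝ (Fin n)}
    (hV0 : V 0 = 0) (hV1 : V 1 = 0) :
    ∫ t in (0 : ℝ)..1, indexDensity g σ' (extendByZero c V) t =
      c * ∫ t in (0 : ℝ)..1, indexDensity g σ V t := by
  have hc0 : 0 < c := by linarith
  have hc1 : 0 < 1 / c := one_div_pos.2 hc0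
  have hc2 : 1 / c < 1 := (div_lt_one hc0).2 hc
  have h1 : ∫ t in (0 : ℝ)..1, indexDensity g σ' (extendByZero c V) t =
      ∫ t in Ioc (0 : ℝ) 1, (Ioc 0 (1 / c)).indicator
        (fun t ↦ c ^ 2 * indexDensity g σ V (c * t)) t := by
    rw [intervalIntegral.integral_of_le zero_le_one]
    refine setIntegral_congr_ae measurableSet_Ioc ?_
    filter_upwards [Measure.ae_ne volume (1 : ℝ), Measure.ae_ne volume (1 / c)]
      with t h1 hne ht01
    rcases lt_or_gt_of_ne hne with hlt | hgt
    · rw [indicator_of_mem (show t ∈ Ioc 0 (1 / c) from ⟨ht01.1, hlt.le⟩),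
        indexDensity_comp_affine g hσ hσ' (h 0) (extendByZero_eventuallyEq hc V ht01.1 hlt)]
      simp
    · rw [indicator_of_notMem (fun hm : t ∈ Ioc 0 (1 / c) ↦ absurd hm.2 (not_le.2 hgt))]
      exact indexDensity_of_eventually_zero g
        (extendByZero_eventually_zero hc hV0 hV1 hgt (lt_of_le_of_ne ht01.2 h1))
  rw [h1, setIntegral_indicator measurableSet_Ioc,
    inter_eq_self_of_subset_right (Ioc_subset_Ioc_right hc2.le),
    ← intervalIntegral.integral_of_le hc1.le, intervalIntegral.integral_const_mul,
    intervalIntegral.integral_comp_mul_left _ hc0.ne', mul_zero, mul_one_div_cancel hc0.ne',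
    smul_eq_mul, ← mul_assoc]
  congr 1
  field_simp

theorem eq_zero_of_extendByZero_eq_zero {c : ℝ} (hc : 1 < c) {V : ℝ → EuclideanSpace ℝ (Fin n)}
    (hper : ∀ t, V (t + 1) = V t) (h : extendByZero c V = 0) : V = 0 := by
  have hc0 : 0 < c := by linarith
  have h1 : ∀ s, 0 ≤ s → s < 1 → V s = 0 := by
    intro s hs0 hs1
    have h2 := congrFun h (s / c)
    have h3 : s / c ≤ 1 / c := by gcongr
    rw [extendByZero_of_le hc V (k := 0) (by simpa using div_nonneg hs0 hc0.le)
      (by simpa using h3)] at h2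
    have e : c * (s / c) + -(c * (0 : ℤ)) = s := by
      simp [mul_div_cancel₀, hc0.ne']
    rwa [e] at h2
  ext1 t
  have hP : Function.Periodic V 1 := hper
  have h2 := hP.sub_int_mul_eq ⌊t⌋ (x := t)
  rw [mul_one] at h2
  rw [← h2]
  exact h1 _ (Int.fract_nonneg t) (Int.fract_lt_one t)

/-- The constraint constant accounts for one dimension and the value at `0` for `n`. On the common
kernel, extension by zero is injective, lands in the constraint space of `σ'` and preserves
negativity. -/
theorem morseIndex_le_add_of_reparametrization (g : LorentzMetric n M)
    {Y : (p : M) → TangentSpace (𝓡 n) p} (hY : IsTimelikeKilling g Y) {σ σ' : ℝ → M}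
    (hσ : ContMDiff 𝓘(ℝ, ℝ) (𝓡 n) ∞ σ) (hσ' : ContMDiff 𝓘(ℝ, ℝ) (𝓡 n) ∞ σ') {c : ℝ} (hc : 1 < c)
    (h : ∀ (k : ℤ) t, σ' t = σ (c * t + -(c * k))) :
    morseIndex g Y σ ≤ morseIndex g Y σ' + (1 + n : ℕ) := by
  have hF : Module.finrank ℝ (ℝ × EuclideanSpace ℝ (Fin n)) = 1 + n := by simp
  rw [← hF]
  refine negIndex_le_add (F := ℝ × EuclideanSpace ℝ (Fin n)) (extendByZero c)
    (morseIndex_ne_top g hY hσ) fun W hW ↦ ?_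
  obtain ⟨C, hC⟩ := exists_constraint_functional g Y hσ W hW
  let ev : W →ₗ[ℝ] EuclideanSpace ℝ (Fin n) :=
    { toFun := fun w ↦ w.1 0
      map_add' := fun _ _ ↦ rfl
      map_smul' := fun _ _ ↦ rfl }
  refine ⟨C.prod ev, fun w hw ↦ ?_⟩
  obtain ⟨V, hVW⟩ := w
  obtain ⟨⟨hS, hper⟩, -⟩ := hW hVW
  have hC0 : C ⟨V, hVW⟩ = 0 := congrArg Prod.fst hw
  have hV0 : (V 0 : EuclideanSpace ℝ (Fin n)) = 0 := congrArg Prod.snd hw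
  have hV1 : (V 1 : EuclideanSpace ℝ (Fin n)) = 0 := by
    have := hper 0
    rw [zero_add] at this
    exact this.trans hV0
  have hcon : ∀ᵐ t ∂(volume.restrict (Icc (0 : ℝ) 1)), constraintDensity g Y σ V t = 0 := by
    have := hC ⟨V, hVW⟩
    rwa [hC0] at this
  refine ⟨⟨⟨isSobolevH1Field_extendByZero hσ'.continuous hc h hS hV0 hV1,
    extendByZero_periodic c V⟩, 0,
    constraintDensity_extendByZero g Y hσ hσ' hc h hV0 hV1 hcon⟩,
    fun h0 ↦ eq_zero_of_extendByZero_eq_zero hc hper h0, fun hneg ↦ ?_⟩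
  have h1 := integral_indexDensity_extendByZero g hσ hσ' hc h hV0 hV1
  have h2 : ∫ t in (0 : ℝ)..1, indexDensity g σ V t < 0 := hneg
  have h3 : ∫ t in (0 : ℝ)..1, indexDensity g σ' (extendByZero c V) t < 0 := by
    rw [h1]
    exact mul_neg_of_pos_of_neg (by linarith) h2
  exact h3

/-- Up to a constant the Morse index of the iterates is nondecreasing. -/
theorem morseIndex_iterate_le (g : LorentzMetric n M) {Y : (p : M) → TangentSpace (𝓡 n) p}
    (hY : IsTimelikeKilling g Y) {γ : ℝ → M} (hγ : ContMDiff 𝓘(ℝ, ℝ) (𝓡 n) ∞ γ)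
    (hper : Function.Periodic γ 1) {N N' : ℕ} (hN : 1 ≤ N) (hNN : N ≤ N') :
    morseIndex g Y (iterateCurve γ N) ≤ morseIndex g Y (iterateCurve γ N') + (1 + n : ℕ) := by
  rcases hNN.eq_or_lt with rfl | hlt
  · exact le_self_add
  have hN0 : (0 : ℝ) < N := by exact_mod_cast hN
  refine morseIndex_le_add_of_reparametrization g hY (contMDiff_iterateCurve hγ N)
    (contMDiff_iterateCurve hγ N') (c := N' / N) ?_ fun k t ↦ ?_
  · rw [one_lt_div hN0]
    exact_mod_cast hlt
  -- Shifting `t` by `k` shifts the parameter of `γ` by the integer `N' k`, a period of `γ`,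
  -- although `c k` need not be an integer.
  · have e : (N : ℝ) * ((N' / N : ℝ) * t + -((N' / N : ℝ) * k)) =
        N' * t - ((N' * k : ℤ) : ℝ) * 1 := by
      push_cast
      field_simp
      ring
    simp only [iterateCurve]
    rw [e, hper.sub_int_mul_eq]

end ExtensionByZero

/-- A sequence that decreases by at most `K` becomes nondecreasing after a bounded correction. -/
theorem exists_bounded_correction {a : ℕ → ℕ} {K : ℕ}
    (h : ∀ N N', 1 ≤ N → N ≤ N' → a N ≤ a N' + K) :
    ∃ d : ℕ → ℤ, (∃ K : ℤ, ∀ N : ℕ, 1 ≤ N → |d N| ≤ K) ∧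
      ∀ N N' : ℕ, 1 ≤ N → N ≤ N' → (a N : ℤ) + d N ≤ (a N' : ℤ) + d N' := by
  have hne : ∀ N, (a '' Ici N).Nonempty := fun N ↦ ⟨a N, N, self_mem_Ici, rfl⟩
  -- The corrected sequence is the infimum of `a` over the tail starting at `N`. It grows as the
  -- tail shrinks, and by hypothesis it lies at most `K` below `a N`.
  refine ⟨fun N ↦ (sInf (a '' Ici N) : ℕ) - a N, ⟨K, fun N hN ↦ ?_⟩, fun N N' _ hNN ↦ ?_⟩
  · have h1 : sInf (a '' Ici N) ≤ a N := Nat.sInf_le ⟨N, self_mem_Ici, rfl⟩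
    obtain ⟨N', hN', hinf⟩ := Nat.sInf_mem (hne N)
    have h2 := h N N' hN hN'
    rw [hinf] at h2
    simp only [abs_le]
    constructor <;> omega
  · have h1 : sInf (a '' Ici N) ≤ sInf (a '' Ici N') := by
      obtain ⟨m, hm, hinf⟩ := Nat.sInf_mem (hne N')
      rw [← hinf]
      exact Nat.sInf_le ⟨m, hNN.trans hm, rfl⟩
    simp only [add_sub_cancel]
    exact_mod_cast h1

end

theorem mainTheorem9 {n : ℕ} {M : Type*} [TopologicalSpace M] [T2Space M]
    [SecondCountableTopology M] [ChartedSpace (EuclideanSpace ℝ (Fin n)) M]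
    [IsManifold (𝓡 n) ∞ M] (g : LorentzMetric n M) (Y : (p : M) → TangentSpace (𝓡 n) p)
    (hY : IsTimelikeKilling g Y) (γ : ℝ → M) (hγ : IsClosedGeodesic g γ) :
    (∀ N : ℕ, 1 ≤ N → morseIndex g Y (iterateCurve γ N) ≠ ⊤) ∧
    ∃ d : ℕ → ℤ, (∃ K : ℤ, ∀ N : ℕ, 1 ≤ N → |d N| ≤ K) ∧
      ∀ N N' : ℕ, 1 ≤ N → N ≤ N' →
        ((morseIndex g Y (iterateCurve γ N)).toNat : ℤ) + d N ≤
          ((morseIndex g Y (iterateCurve γ N')).toNat : ℤ) + d N' := by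
  have hfin : ∀ N : ℕ, morseIndex g Y (iterateCurve γ N) ≠ ⊤ := fun N ↦
    morseIndex_ne_top g hY (contMDiff_iterateCurve hγ.contMDiff N)
  refine ⟨fun N _ ↦ hfin N, exists_bounded_correction (K := 1 + n) fun N N' hN hNN ↦ ?_⟩
  have h := morseIndex_iterate_le g hY hγ.contMDiff hγ.periodic hN hNN
  -- Since the indices are finite, `toNat` returns their true values and the inequality in `ℕ∞`
  -- descends to `ℕ`.
  rw [← ENat.natCast_toNat (hfin N), ← ENat.natCast_toNat (hfin N')] at h
  exact_mod_cast h
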